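/- Let $(M,g)$ be a smooth finite-dimensional manifold with a smooth positive definite Riemannian metric, Levi-Civita connection $\nabla$, curvature tensor $R(X,Y)Z=\nabla_X\nabla_YZ-\nabla_Y\nabla_XZ-\nabla_{[X,Y]}Z$ and Ricci tensor $\mathrm{Ric}(X,Y)=\mathrm{tr}(Z\mapsto R(Z,X)Y)$. Suppose that $(M,g)$ is a $\mathfrak{C}_0$-space: for every geodesic $\gamma\colon I\to M$ on an open interval $I$, there is a parallel skew-symmetric endomorphism field $C_\gamma$ along $\gamma$ such that the Jacobi operator $\mathcal{R}_\gamma=R(\,\cdot\,,\dot\gamma)\dot\gamma$ satisfies $\frac{\nabla}{dt}\mathcal{R}_\gamma=[C_\gamma,\mathcal{R}_\gamma]$ on $I$. Let $p\in M$. For $j\ge 0$ and $X\in T_pM$ define $\mathcal{R}^j(X)\in\mathrm{End}(T_pM)$ by $\mathcal{R}^j(X)Y=(\nabla^j_{X,\dots,X}R)(Y,X)X$. A minimal polynomial of $(M,g)$ at $p$ is a polynomial $P=\sum_{i=0}^k a_i\lambda^{k-i}$ with $a_0=1$, where each $a_i$ is a homogeneous real polynomial function of degree $i$ on $T_pM$,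 such that $\sum_{i=0}^k a_i(X)\,\mathcal{R}^{k-i}(X)=0$ for all $X\in T_pM$, and such that the set $$U(p)=\{X\in T_pM : \mathcal{R}^0(X),\dots,\mathcal{R}^{k-1}(X)\text{ are linearly independent in }\mathrm{End}(T_pM)\}$$ is nonempty. Then there is exactly one minimal polynomial $P=\sum_{i=0}^k a_i\lambda^{k-i}$ of $(M,g)$ at $p$, and $$P=\sum_{i=0}^{\lfloor k/2\rfloor}a_{2i}\,\lambda^{k-2i}.$$ For every $0\le i\le\lfloor k/2\rfloor$, one has $a_{2i}(X)\ge 0$ for all $X\in T_pM$ and $a_{2i}(X)>0$ for all $X\in U(p)$. If moreover $\mathrm{Ric}|_p\ne 0$, then $k$ is odd. -/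

import Mathlib

open scoped Manifold ContDiff

noncomputable section

namespace RiemannJet

/-! ### Local Riemannian geometry in coordinates

`G : E → E →L[ℝ] E →L[ℝ] ℝ` is the coordinate expression of a metric on an open part of the model
space `E`; tensor fields of type `(1, m)` are maps into the `E`-valued `m`-linear maps on `E`. -/

section Coordinates

variable {E : Type*} [NormedAddCommGroup E] [NormedSpace ℝ E]

/-- The Christoffel symbols `Γ_x(u, v)` of the Levi-Civita connection, determined by
`G_x(Γ_x(u, v), w) = (D_u G (v, w) + D_v G (u, w) - D_w G (u, v)) / 2`; indices are raised with
the inverse of `G x : E → (E →L[ℝ] ℝ)`. -/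
def christoffel (G : E → E →L[ℝ] E →L[ℝ] ℝ) (x : E) : E →L[ℝ] E →L[ℝ] E :=
  let D : E →L[ℝ] E →L[ℝ] E →L[ℝ] ℝ := fderiv ℝ G x
  let raise : (E →L[ℝ] E →L[ℝ] ℝ) →L[ℝ] (E →L[ℝ] E) :=
    ContinuousLinearMap.compL ℝ E (E →L[ℝ] ℝ) E (G x).inverse
  let flipL : (E →L[ℝ] E →L[ℝ] ℝ) →L[ℝ] (E →L[ℝ] E →L[ℝ] ℝ) :=
    (ContinuousLinearMap.flipₗᵢ ℝ E E ℝ).toContinuousLinearEquiv.toContinuousLinearMap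
  let A : E →L[ℝ] E →L[ℝ] E := raise.comp D
  let B : E →L[ℝ] E →L[ℝ] E := raise.comp (flipL.comp D.flip)
  (2⁻¹ : ℝ) • (A + A.flip - B)

theorem christoffel_apply (G : E → E →L[ℝ] E →L[ℝ] ℝ) (x u v : E) :
    christoffel G x u v = (2⁻¹ : ℝ) • (G x).inverse
      (fderiv ℝ G x u v + fderiv ℝ G x v u - ((fderiv ℝ G x).flip u).flip v) := by
  simp only [map_add, map_sub]
  rfl

theorem apply_christoffel (G : E → E →L[ℝ] E →L[ℝ] ℝ) (x u v w : E) (h : (G x).IsInvertible) :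
    G x (christoffel G x u v) w =
      2⁻¹ * (fderiv ℝ G x u v w + fderiv ℝ G x v u w - fderiv ℝ G x w u v) := by
  obtain ⟨e, he⟩ := h
  have key : ∀ φ : E →L[ℝ] ℝ, G x ((G x).inverse φ) = φ := fun φ => by
    rw [← he, ContinuousLinearMap.inverse_equiv]; simp
  rw [christoffel_apply, map_smul, key]
  simp

/-- The curvature tensor `R(u, v) w` of the Levi-Civita connection. -/
def curvature (G : E → E →L[ℝ] E →L[ℝ] ℝ) (x : E) : E →L[ℝ] E →L[ℝ] E →L[ℝ] E :=
  let S : E →L[ℝ] E →L[ℝ] E →L[ℝ] E := fderiv ℝ (christoffel G) x +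
    (ContinuousLinearMap.compL ℝ E E E).bilinearComp (christoffel G x) (christoffel G x)
  S - S.flip

theorem curvature_apply (G : E → E →L[ℝ] E →L[ℝ] ℝ) (x u v w : E) :
    curvature G x u v w =
      fderiv ℝ (christoffel G) x u v w - fderiv ℝ (christoffel G) x v u w
        + christoffel G x u (christoffel G x v w) - christoffel G x v (christoffel G x u w) := by
  simp [curvature]
  abel

/-- The curvature tensor as a tensor field of type `(1, 3)`. -/
def curvatureTensor (G : E → E →L[ℝ] E →L[ℝ] ℝ) (x : E) :
    ContinuousMultilinearMap ℝ (fun _ : Fin 3 => E) E where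
  toFun v := curvature G x (v 0) (v 1) (v 2)
  map_update_add' {inst} v i a b := by
    obtain rfl := Subsingleton.elim inst (instDecidableEqFin 3)
    obtain rfl | rfl | rfl : i = 0 ∨ i = 1 ∨ i = 2 := by omega
    all_goals simp
  map_update_smul' {inst} v i c a := by
    obtain rfl := Subsingleton.elim inst (instDecidableEqFin 3)
    obtain rfl | rfl | rfl : i = 0 ∨ i = 1 ∨ i = 2 := by omega
    all_goals simp
  cont := by fun_prop

/-- The action `(v₁, …, v_m) ↦ ∑ i, T (v₁, …, A v_i, …, v_m)` of an endomorphism `A` on an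
`m`-linear map `T`, as a linear function of `A`. -/
def slotAction {m : ℕ} (T : ContinuousMultilinearMap ℝ (fun _ : Fin m => E) E) :
    (E →L[ℝ] E) →L[ℝ] ContinuousMultilinearMap ℝ (fun _ : Fin m => E) E :=
  ∑ i, ((ContinuousMultilinearMap.compContinuousLinearMapContinuousMultilinear ℝ
    (fun _ : Fin m => E) (fun _ : Fin m => E) E).toContinuousLinearMap
      (fun _ => ContinuousLinearMap.id ℝ E) i).flip T

theorem slotAction_apply {m : ℕ} (T : ContinuousMultilinearMap ℝ (fun _ : Fin m => E) E)
    (A : E →L[ℝ] E) (v : Fin m → E) :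
    slotAction T A v = ∑ i, T (Function.update v i (A (v i))) := by
  simp only [slotAction, sum_apply]
  refine Finset.sum_congr rfl fun i _ => ?_
  change T (fun j => Function.update (fun _ : Fin m => ContinuousLinearMap.id ℝ E) i A j (v j)) = _
  congr 1
  funext j
  by_cases h : j = i
  · subst h; simp
  · simp [h]

/-- The covariant derivative of a tensor field of type `(1, m)`; the new argument, which is the
direction of differentiation, comes first. -/
def covDeriv {m : ℕ} (G : E → E →L[ℝ] E →L[ℝ] ℝ)
    (T : E → ContinuousMultilinearMap ℝ (fun _ : Fin m => E) E) (x : E) :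
    ContinuousMultilinearMap ℝ (fun _ : Fin (m + 1) => E) E :=
  ContinuousLinearMap.uncurryLeft (Ei := fun _ : Fin (m + 1) => E)
    (fderiv ℝ T x
      + ((ContinuousLinearMap.compContinuousMultilinearMapL ℝ (fun _ : Fin m => E) E E).flip
          (T x)).comp (christoffel G x)
      - (slotAction (T x)).comp (christoffel G x))

theorem covDeriv_apply {m : ℕ} (G : E → E →L[ℝ] E →L[ℝ] ℝ)
    (T : E → ContinuousMultilinearMap ℝ (fun _ : Fin m => E) E) (x : E) (v : Fin (m + 1) → E) :
    covDeriv G T x v = fderiv ℝ T x (v 0) (Fin.tail v)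
      + christoffel G x (v 0) (T x (Fin.tail v))
      - ∑ i, T x (Function.update (Fin.tail v) i (christoffel G x (v 0) (Fin.tail v i))) := by
  simp [covDeriv, ← slotAction_apply]

/-- The iterated covariant derivative `∇^k R`: the first `k` arguments are the directions of
differentiation, the last three are the arguments of `R`. -/
def iteratedCovDerivCurvature (G : E → E →L[ℝ] E →L[ℝ] ℝ) :
    (k : ℕ) → E → ContinuousMultilinearMap ℝ (fun _ : Fin (k + 3) => E) E
  | 0 => curvatureTensor G
  | k + 1 => covDeriv G (iteratedCovDerivCurvature G k)

/-- The endomorphism `Y ↦ (∇^k_{X, …, X} R)(Y, X) X`. -/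
def symCurvatureCoord (G : E → E →L[ℝ] E →L[ℝ] ℝ) (k : ℕ) (x X : E) : E →L[ℝ] E :=
  (iteratedCovDerivCurvature G k x).toContinuousLinearMap (fun _ => X) ⟨k, by omega⟩

/-- The Jacobi operator `Y ↦ R(Y, X) X`. -/
def jacobiCoord (G : E → E →L[ℝ] E →L[ℝ] ℝ) (x X : E) : E →L[ℝ] E :=
  ((curvature G x).flip X).flip X

theorem jacobiCoord_apply (G : E → E →L[ℝ] E →L[ℝ] ℝ) (x X Y : E) :
    jacobiCoord G x X Y = curvature G x Y X X := rfl

theorem symCurvatureCoord_zero (G : E → E →L[ℝ] E →L[ℝ] ℝ) (x X : E) :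
    symCurvatureCoord G 0 x X = jacobiCoord G x X := by
  ext Y
  change curvature G x (Function.update (fun _ : Fin 3 => X) 0 Y 0)
    (Function.update (fun _ : Fin 3 => X) 0 Y 1) (Function.update (fun _ : Fin 3 => X) 0 Y 2) = _
  simp [jacobiCoord]

/-- The covariant derivative `∇A/dt` of an endomorphism field `A` along a curve `c`,
`(∇A/dt) Y = ∇(A Y)/dt - A (∇Y/dt)`, in coordinates. -/
def covDerivAlong (G : E → E →L[ℝ] E →L[ℝ] ℝ) (c : ℝ → E) (A : ℝ → E →L[ℝ] E) (t : ℝ) :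
    E →L[ℝ] E :=
  deriv A t + (christoffel G (c t) (deriv c t)).comp (A t)
    - (A t).comp (christoffel G (c t) (deriv c t))

end Coordinates

/-! ### Riemannian manifolds -/

section Manifold

variable {E : Type*} [NormedAddCommGroup E] [NormedSpace ℝ E]
  {M : Type*} [TopologicalSpace M] [ChartedSpace E M] [IsManifold 𝓘(ℝ, E) ∞ M]

/-- The coordinate expression of the metric in the chart `e`. -/
def chartMetric (g : Bundle.ContMDiffRiemannianMetric 𝓘(ℝ, E) ∞ E
      (fun x : M => TangentSpace 𝓘(ℝ, E) x))
    (e : OpenPartialHomeomorph M E) (x : E) : E →L[ℝ] E →L[ℝ] ℝ :=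
  let D : E →L[ℝ] TangentSpace 𝓘(ℝ, E) (e.symm x) := mfderiv 𝓘(ℝ, E) 𝓘(ℝ, E) e.symm x
  (ContinuousLinearMap.precomp ℝ D).comp ((g.inner (e.symm x)).comp D)

theorem chartMetric_apply (g : Bundle.ContMDiffRiemannianMetric 𝓘(ℝ, E) ∞ E
      (fun x : M => TangentSpace 𝓘(ℝ, E) x))
    (e : OpenPartialHomeomorph M E) (x u v : E) :
    chartMetric g e x u v = g.inner (e.symm x) (mfderiv 𝓘(ℝ, E) 𝓘(ℝ, E) e.symm x u)
      (mfderiv 𝓘(ℝ, E) 𝓘(ℝ, E) e.symm x v) := rfl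

/-- The matrix in the chart `e` of an endomorphism `A` of the tangent space at `q`. -/
def endoInChart (e : OpenPartialHomeomorph M E) (q : M)
    (A : TangentSpace 𝓘(ℝ, E) q →L[ℝ] TangentSpace 𝓘(ℝ, E) q) : E →L[ℝ] E :=
  let D : TangentSpace 𝓘(ℝ, E) q →L[ℝ] E := mfderiv 𝓘(ℝ, E) 𝓘(ℝ, E) e q
  let D' : E →L[ℝ] TangentSpace 𝓘(ℝ, E) q := D.inverse
  D.comp (A.comp D')

/-- `γ` is a geodesic on the open set `s` of parameters: it is twice continuously differentiable
and near each parameter it satisfies the geodesic equation in a chart of the maximal atlas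
(the choice of the chart does not matter, as the equation is invariant under coordinate
changes). -/
def IsGeodesicOn (g : Bundle.ContMDiffRiemannianMetric 𝓘(ℝ, E) ∞ E
      (fun x : M => TangentSpace 𝓘(ℝ, E) x)) (γ : ℝ → M) (s : Set ℝ) : Prop :=
  ContMDiffOn 𝓘(ℝ, ℝ) 𝓘(ℝ, E) 2 γ s ∧
  ∀ t ∈ s, ∃ e ∈ IsManifold.maximalAtlas 𝓘(ℝ, E) ∞ M, γ t ∈ e.source ∧
    deriv (deriv (e ∘ γ)) t +
      christoffel (chartMetric g e) (e (γ t)) (deriv (e ∘ γ) t) (deriv (e ∘ γ) t) = 0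

/-- `(M, g)` is a `ℭ₀`-space: along every geodesic `γ : I → M`, `I` an open interval, there is a
parallel skew-symmetric endomorphism field `C` such that the covariant derivative along `γ` of the
Jacobi operator `R_γ = R(·, γ') γ'` is the commutator `[C, R_γ]`. That `C` is parallel and the
commutator equation are expressed in local coordinates, in every chart of the maximal atlas. -/
def IsC0Space (g : Bundle.ContMDiffRiemannianMetric 𝓘(ℝ, E) ∞ E
      (fun x : M => TangentSpace 𝓘(ℝ, E) x)) : Prop :=
  ∀ (I : Set ℝ) (γ : ℝ → M), IsOpen I → I.OrdConnected → IsGeodesicOn g γ I →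
    ∃ C : (t : ℝ) → TangentSpace 𝓘(ℝ, E) (γ t) →L[ℝ] TangentSpace 𝓘(ℝ, E) (γ t),
      (∀ t ∈ I, ∀ u v : TangentSpace 𝓘(ℝ, E) (γ t),
        g.inner (γ t) (C t u) v = - g.inner (γ t) u (C t v)) ∧
      ∀ e ∈ IsManifold.maximalAtlas 𝓘(ℝ, E) ∞ M, ∀ t ∈ I, γ t ∈ e.source →
        let G := chartMetric g e
        let c : ℝ → E := e ∘ γ
        let Ce : ℝ → E →L[ℝ] E := fun t => endoInChart e (γ t) (C t)
        let J : ℝ → E →L[ℝ] E := fun t => jacobiCoord G (c t) (deriv c t)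
        DifferentiableAt ℝ Ce t ∧ covDerivAlong G c Ce t = 0 ∧
          covDerivAlong G c J t = (Ce t).comp (J t) - (J t).comp (Ce t)

/-- The symmetrized `k`th covariant derivative of the curvature tensor at `p`,
`𝓡^k(X) Y = (∇^k_{X, …, X} R)(Y, X) X` for `X, Y` in the tangent space at `p`. It is computed in
the preferred chart at `p` and carried back to the tangent space. -/
def symCurvature (g : Bundle.ContMDiffRiemannianMetric 𝓘(ℝ, E) ∞ E
      (fun x : M => TangentSpace 𝓘(ℝ, E) x)) (p : M) (k : ℕ) (X : TangentSpace 𝓘(ℝ, E) p) :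
    TangentSpace 𝓘(ℝ, E) p →L[ℝ] TangentSpace 𝓘(ℝ, E) p :=
  let e := chartAt E p
  let D : TangentSpace 𝓘(ℝ, E) p →L[ℝ] E := mfderiv 𝓘(ℝ, E) 𝓘(ℝ, E) e p
  let D' : E →L[ℝ] TangentSpace 𝓘(ℝ, E) p := D.inverse
  D'.comp ((symCurvatureCoord (chartMetric g e) k (e p) (D X)).comp D)

/-- The Ricci tensor at `p`, `Ric(X, Y) = tr (Z ↦ R(Z, X) Y)`. -/
def ricci (g : Bundle.ContMDiffRiemannianMetric 𝓘(ℝ, E) ∞ E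
      (fun x : M => TangentSpace 𝓘(ℝ, E) x)) (p : M) (X Y : TangentSpace 𝓘(ℝ, E) p) : ℝ :=
  let e := chartAt E p
  let D : TangentSpace 𝓘(ℝ, E) p →L[ℝ] E := mfderiv 𝓘(ℝ, E) 𝓘(ℝ, E) e p
  LinearMap.trace ℝ E
    (((curvature (chartMetric g e) (e p)).flip (D X)).flip (D Y) : E →L[ℝ] E).toLinearMap

end Manifold

/-! ### Polynomial functions and minimal polynomials -/

/-- The algebra of real-valued polynomial functions on a real vector space `V`: the algebra of
functions generated by the linear functionals. -/
def PolyFun (V : Type*) [AddCommGroup V] [Module ℝ V] : Subalgebra ℝ (V → ℝ) :=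
  Algebra.adjoin ℝ (Set.range fun φ : Module.Dual ℝ V => (φ : V → ℝ))

/-- A polynomial function is homogeneous of degree `i`. -/
def IsHomogeneousFun {V : Type*} [AddCommGroup V] [Module ℝ V] (i : ℕ) (a : PolyFun V) : Prop :=
  ∀ (t : ℝ) (X : V), a.1 (t • X) = t ^ i * a.1 X

section MinimalPolynomial

variable {E : Type*} [NormedAddCommGroup E] [NormedSpace ℝ E]
  {M : Type*} [TopologicalSpace M] [ChartedSpace E M] [IsManifold 𝓘(ℝ, E) ∞ M]

/-- Evaluation of a polynomial in `λ` with polynomial functions on the tangent space as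
coefficients on the symmetrized jet of the curvature tensor: `λ ^ j` is replaced by `𝓡^j`. -/
def evalJet (g : Bundle.ContMDiffRiemannianMetric 𝓘(ℝ, E) ∞ E
      (fun x : M => TangentSpace 𝓘(ℝ, E) x)) (p : M)
    (P : Polynomial (PolyFun (TangentSpace 𝓘(ℝ, E) p))) (X : TangentSpace 𝓘(ℝ, E) p) :
    TangentSpace 𝓘(ℝ, E) p →L[ℝ] TangentSpace 𝓘(ℝ, E) p :=
  ∑ j ∈ Finset.range (P.natDegree + 1), (P.coeff j).1 X • symCurvature g p j X

/-- The set of those tangent vectors `X` at `p` for which `𝓡^0(X), …, 𝓡^{k-1}(X)` are linearly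
independent. -/
def regularSet (g : Bundle.ContMDiffRiemannianMetric 𝓘(ℝ, E) ∞ E
      (fun x : M => TangentSpace 𝓘(ℝ, E) x)) (p : M) (k : ℕ) : Set (TangentSpace 𝓘(ℝ, E) p) :=
  {X | LinearIndependent ℝ fun j : Fin k => symCurvature g p j X}

/-- The coefficient `a_i` of `P = ∑ i ≤ k, a_i λ ^ (k - i)`, where `k` is the degree of `P`, as a
function on the tangent space; it is meant for `i ≤ k`. -/
def coeffFun {V : Type*} [AddCommGroup V] [Module ℝ V] (P : Polynomial (PolyFun V)) (i : ℕ) :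
    PolyFun V :=
  P.coeff (P.natDegree - i)

/-- `P = ∑ i ≤ k, a_i λ ^ (k - i)` is a minimal polynomial of `(M, g)` at `p`: it is monic and
homogeneous (`a_i` is homogeneous of degree `i`), it is admissible (its evaluation on the
symmetrized jet vanishes), and the set `U(p)` is nonempty. -/
structure IsMinimalPolynomial (g : Bundle.ContMDiffRiemannianMetric 𝓘(ℝ, E) ∞ E
      (fun x : M => TangentSpace 𝓘(ℝ, E) x)) (p : M)
    (P : Polynomial (PolyFun (TangentSpace 𝓘(ℝ, E) p))) : Prop where
  monic : P.Monic
  homogeneous : ∀ i ≤ P.natDegree, IsHomogeneousFun i (coeffFun P i)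
  admissible : ∀ X, evalJet g p P X = 0
  regular : (regularSet g p P.natDegree).Nonempty

end MinimalPolynomial

end RiemannJet

end

set_option maxSynthPendingDepth 3

noncomputable section

namespace RiemannJet

/-! ### The ring of polynomial functions -/

section PolyFunRing

variable {V : Type*} [AddCommGroup V] [Module ℝ V]

/-! Fix `X` and take the geodesic with initial velocity `X`. Along it the covariant derivative of
`𝓡^j(γ')` is `𝓡^{j+1}(γ')`, and since `C` is parallel, differentiating `∇𝓡/dt = [C, 𝓡]` repeatedly
gives `𝓡^{j+1}(X) = [S, 𝓡^j(X)]` with one endomorphism `S = C(0)`, skew for the metric at `p`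
(`exists_skew_commutator`). So the jet is the orbit of `𝓡^0(X)` under `ad S`, which is skew for the
trace form on endomorphisms (`traceForm_commutator`). Nothing is known about how `S` depends on `X`;
only the `𝓡^j(X)` are polynomial in `X`.

Let `A` be the ring of polynomial functions on the tangent space. Applying `ad S` at each `X` shows
that the relations `∑ f_j(X) 𝓡^j(X) = 0` form an ideal of `A[λ]`. As `A` is Noetherian, the ideal
contains a monic polynomial; as `A` is integrally closed, Gauss's lemma yields a monic element `P`
of least degree `k` (`exists_monic_minimal_annihilator`). Minimality makes the Gram determinant of
`𝓡^0, …, 𝓡^{k-1}` a nonzero polynomial function, so a generic `X` lies in `U(p)`. This gives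
existence, uniqueness and homogeneity.

For `X` in `U(p)`, `P` at `X` is the minimal annihilator of `𝓡^0(X)` under a skew operator. Spectral
theory gives it the form `λ^ε ∏ (λ² + θ_i²)` with `ε ≤ 1` and `θ_i ≠ 0`, hence the parity and the
positive coefficients (`minimal_annihilator_of_skew`). Vanishing and nonnegativity extend from
generic `X` to all `X`.

If `k` is even, then `ε = 0`, so `𝓡^0(X)` is a commutator for generic `X` and `Ric(X, X) = tr
𝓡^0(X)` vanishes there, hence everywhere. Polarization and the symmetry of `Ric` give `Ric = 0`. -/

theorem dual_mem_polyFun (φ : Module.Dual ℝ V) : (φ : V → ℝ) ∈ PolyFun V :=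
  Algebra.subset_adjoin ⟨φ, rfl⟩

/-- Evaluation of polynomials at the coordinates of a vector. -/
def coordEval {ι : Type*} (b : Module.Basis ι ℝ V) : MvPolynomial ι ℝ →ₐ[ℝ] (V → ℝ) :=
  MvPolynomial.aeval fun i => (b.coord i : V → ℝ)

theorem coordEval_apply {ι : Type*} (b : Module.Basis ι ℝ V) (q : MvPolynomial ι ℝ) (X : V) :
    coordEval b q X = MvPolynomial.eval (fun i => b.coord i X) q := by
  have : (Pi.evalAlgHom ℝ (fun _ : V => ℝ) X).comp (coordEval b) =
      MvPolynomial.aeval fun i => b.coord i X := by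
    ext i; simp [coordEval]
  exact DFunLike.congr_fun this q

theorem coordEval_injective {ι : Type*} [Finite ι] (b : Module.Basis ι ℝ V) :
    Function.Injective (coordEval b) := by
  intro p q h
  refine MvPolynomial.funext fun x => ?_
  have := congrFun h (b.equivFun.symm x)
  simp only [coordEval_apply] at this
  have hx : (fun i => b.coord i (b.equivFun.symm x)) = x := by
    funext i
    rw [Module.Basis.coord_apply, ← Module.Basis.equivFun_apply,
      LinearEquiv.apply_symm_apply]
  rwa [hx] at this

theorem range_coordEval {ι : Type*} [Fintype ι] (b : Module.Basis ι ℝ V) :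
    (coordEval b).range = PolyFun V := by
  rw [coordEval, ← Algebra.adjoin_range_eq_range_aeval]
  refine le_antisymm (Algebra.adjoin_mono ?_) (Algebra.adjoin_le ?_)
  · rintro _ ⟨i, rfl⟩
    exact ⟨b.coord i, rfl⟩
  · rintro _ ⟨φ, rfl⟩
    have : (φ : V → ℝ) = ∑ i, φ (b i) • (b.coord i : V → ℝ) := by
      funext X
      conv_lhs => rw [← b.sum_repr X]
      rw [map_sum]
      simp [-Module.Basis.sum_repr, mul_comm]
    change (φ : V → ℝ) ∈ _
    rw [this]
    exact Subalgebra.sum_mem _ fun i _ =>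
      Subalgebra.smul_mem _ (Algebra.subset_adjoin (Set.mem_range_self i)) _

/-- The ring of polynomial functions is a polynomial ring. -/
def polyFunEquiv {ι : Type*} [Fintype ι] (b : Module.Basis ι ℝ V) :
    MvPolynomial ι ℝ ≃ₐ[ℝ] PolyFun V :=
  (AlgEquiv.ofInjective (coordEval b) (coordEval_injective b)).trans
    (Subalgebra.equivOfEq _ _ (range_coordEval b))

variable [FiniteDimensional ℝ V]

/-- The ring properties behind the Noetherian argument and Gauss's lemma, transported from the
polynomial ring in coordinates. -/
instance : IsDomain (PolyFun V) :=
  (polyFunEquiv (Module.finBasis ℝ V)).symm.toMulEquiv.isDomain _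

instance : IsNoetherianRing (PolyFun V) :=
  isNoetherianRing_of_ringEquiv _ (polyFunEquiv (Module.finBasis ℝ V)).toRingEquiv

instance : IsIntegrallyClosed (PolyFun V) :=
  IsIntegrallyClosed.of_equiv (polyFunEquiv (Module.finBasis ℝ V)).toRingEquiv

omit [FiniteDimensional ℝ V] in
/-- The restriction of a polynomial function to an affine line is a polynomial. -/
theorem exists_polynomial_on_line (X Y : V) (f : PolyFun V) :
    ∃ q : Polynomial ℝ, ∀ t : ℝ, q.eval t = f.1 (X + t • Y) := by
  obtain ⟨f, hf⟩ := f
  induction hf using Algebra.adjoin_induction with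
  | mem _ hx =>
    obtain ⟨φ, rfl⟩ := hx
    exact ⟨Polynomial.C (φ X) + Polynomial.C (φ Y) * Polynomial.X, fun t => by
      simp; ring⟩
  | algebraMap r => exact ⟨Polynomial.C r, fun t => by simp⟩
  | add f g _ _ h₁ h₂ =>
    obtain ⟨p, hp⟩ := h₁
    obtain ⟨q, hq⟩ := h₂
    exact ⟨p + q, fun t => by simp [hp, hq]⟩
  | mul f g _ _ h₁ h₂ =>
    obtain ⟨p, hp⟩ := h₁
    obtain ⟨q, hq⟩ := h₂
    exact ⟨p * q, fun t => by simp [hp, hq]⟩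

omit [FiniteDimensional ℝ V] in
/-- A polynomial function which is nonnegative off the zero set of a nonzero polynomial function
is nonnegative. -/
theorem nonneg_of_nonneg_off_zeros {f h : PolyFun V} (hh : h ≠ 0)
    (H : ∀ X, h.1 X ≠ 0 → 0 ≤ f.1 X) (X : V) : 0 ≤ f.1 X := by
  obtain ⟨Z, hZ⟩ : ∃ Z, h.1 Z ≠ 0 := by
    by_contra! hcon
    exact hh (Subtype.ext (funext hcon))
  -- On the line from `X` (at `t = 0`) to `Z` (at `t = 1`), `h` is a nonzero polynomial with
  -- finitely many roots. So `f ≥ 0` for small `t ≠ 0`, and `t → 0` gives the claim.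
  obtain ⟨p, hp⟩ := exists_polynomial_on_line X (Z - X) f
  obtain ⟨q, hq⟩ := exists_polynomial_on_line X (Z - X) h
  have hq0 : q ≠ 0 := by
    rintro rfl
    have := hq 1
    simp at this
    exact hZ this.symm
  have hev : ∀ᶠ t in nhdsWithin (0 : ℝ) {0}ᶜ, 0 ≤ p.eval t := by
    have hfin : (↑q.roots.toFinset : Set ℝ)ᶜ ∪ {0} ∈ nhds (0 : ℝ) := by
      have : ((↑q.roots.toFinset : Set ℝ) \ {0})ᶜ ∈ nhds (0 : ℝ) :=
        ((q.roots.toFinset.finite_toSet.subset Set.sdiff_subset).isClosed.isOpen_compl).mem_nhds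
          (by simp)
      refine Filter.mem_of_superset this ?_
      intro t ht
      by_contra hcon
      simp only [Set.mem_union, not_or, Set.mem_compl_iff, not_not] at hcon
      exact ht ⟨hcon.1, hcon.2⟩
    filter_upwards [mem_nhdsWithin_of_mem_nhds hfin, self_mem_nhdsWithin] with t ht ht0
    rw [hp]
    refine H _ fun h0 => ?_
    rcases ht with ht | ht
    · refine ht ?_
      simp only [Finset.mem_coe, Multiset.mem_toFinset]
      rw [Polynomial.mem_roots hq0, Polynomial.IsRoot, hq, h0]
    · exact ht0 ht
  have hlim : Filter.Tendsto (fun t => p.eval t) (nhdsWithin (0 : ℝ) {0}ᶜ) (nhds (p.eval 0)) :=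
    (p.continuous.tendsto 0).mono_left nhdsWithin_le_nhds
  have := ge_of_tendsto hlim hev
  simpa [hp] using this

omit [FiniteDimensional ℝ V] in
/-- A polynomial function which scales with degree `i` under nonzero factors is homogeneous of
degree `i`. -/
theorem isHomogeneousFun_of_ne_zero {i : ℕ} {f : PolyFun V}
    (H : ∀ t : ℝ, t ≠ 0 → ∀ X, f.1 (t • X) = t ^ i * f.1 X) : IsHomogeneousFun i f := by
  intro t X
  obtain ⟨p, hp⟩ := exists_polynomial_on_line 0 X f
  have : p = Polynomial.C (f.1 X) * Polynomial.X ^ i := by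
    refine Polynomial.eq_of_infinite_eval_eq _ _ ((Set.finite_singleton (0 : ℝ)).infinite_compl.mono
      fun s hs => ?_)
    have := hp s
    rw [zero_add, H s hs] at this
    simpa [mul_comm (s ^ i)] using this
  have h := hp t
  rw [this, zero_add] at h
  simpa [mul_comm (t ^ i)] using h.symm

omit [FiniteDimensional ℝ V] in
/-- A multilinear form evaluated at vectors depending polynomially on `X` is a polynomial
function. -/
theorem multilinear_mem_polyFun {m : ℕ} {U : Type*} [AddCommGroup U] [Module ℝ U]
    [FiniteDimensional ℝ U] (T : MultilinearMap ℝ (fun _ : Fin m => U) ℝ)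
    (v : Fin m → V → U) (hv : ∀ i (φ : Module.Dual ℝ U), (fun X => φ (v i X)) ∈ PolyFun V) :
    (fun X => T fun i => v i X) ∈ PolyFun V := by
  classical
  let b := Module.finBasis ℝ U
  have : (fun X => T fun i => v i X) =
      ∑ r : Fin m → Fin (Module.finrank ℝ U),
        (T fun i => b (r i)) • ∏ i, (fun X => b.coord (r i) (v i X)) := by
    funext X
    have hX : (fun i => v i X) = fun i => ∑ j, b.coord j (v i X) • b j := by
      funext i
      exact (b.sum_repr (v i X)).symm
    rw [hX, MultilinearMap.map_sum]
    simp [MultilinearMap.map_smul_univ, mul_comm]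
  rw [this]
  exact Subalgebra.sum_mem _ fun r _ => Subalgebra.smul_mem _
    (Subalgebra.prod_mem _ fun i _ => hv i _) _

end PolyFunRing

/-! ### Linear recurrences over an integrally closed ring -/

section Recurrence

open Polynomial

variable {A : Type*} [CommRing A]

/-- Substitution of `v j` for `λ ^ j`. -/
def substSeq {N : Type*} [AddCommGroup N] [Module A N] (v : ℕ → N) : A[X] →ₗ[A] N :=
  Polynomial.lsum fun j => LinearMap.toSpanSingleton A N (v j)

theorem substSeq_apply {N : Type*} [AddCommGroup N] [Module A N] (v : ℕ → N) (F : A[X]) :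
    substSeq v F = F.sum fun j a => a • v j := rfl

theorem substSeq_eq_sum_range {N : Type*} [AddCommGroup N] [Module A N] (v : ℕ → N) (F : A[X])
    {n : ℕ} (hn : F.natDegree < n) :
    substSeq v F = ∑ j ∈ Finset.range n, F.coeff j • v j := by
  rw [substSeq_apply, Polynomial.sum_over_range' _ (by simp) n hn]

theorem substSeq_monomial {N : Type*} [AddCommGroup N] [Module A N] (v : ℕ → N) (j : ℕ) (a : A) :
    substSeq v (monomial j a) = a • v j := by
  rw [substSeq_apply, sum_monomial_index _ _ (by simp)]

/-- The ideal of polynomials annihilating the sequence `v`. -/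
def annihilatingIdeal {N : Type*} [AddCommGroup N] [Module A N] (v : ℕ → N)
    (h : ∀ F : A[X], substSeq v F = 0 → substSeq v (X * F) = 0) : Ideal A[X] where
  carrier := {F | substSeq v F = 0}
  add_mem' := fun {a b} ha hb => by
    simp only [Set.mem_ofPred_eq] at *
    rw [map_add, ha, hb, add_zero]
  zero_mem' := map_zero _
  smul_mem' := fun c F hF => by
    simp only [Set.mem_ofPred_eq, smul_eq_mul] at *
    have hpow : ∀ n : ℕ, substSeq v (X ^ n * F) = 0 := fun n => by
      induction n with
      | zero => simpa using hF
      | succ n ih => rw [pow_succ', mul_assoc]; exact h _ ih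
    induction c using Polynomial.induction_on' with
    | add p q hp hq => rw [add_mul, map_add, hp, hq, add_zero]
    | monomial n a =>
      rw [← C_mul_X_pow_eq_monomial, mul_assoc, ← smul_eq_C_mul, map_smul, hpow, smul_zero]

theorem mem_annihilatingIdeal {N : Type*} [AddCommGroup N] [Module A N] {v : ℕ → N}
    {h : ∀ F : A[X], substSeq v F = 0 → substSeq v (X * F) = 0} {F : A[X]} :
    F ∈ annihilatingIdeal v h ↔ substSeq v F = 0 := Iff.rfl

/-- A sequence in a Noetherian module satisfies a monic relation. -/
theorem exists_monic_substSeq_eq_zero {N : Type*} [AddCommGroup N] [Module A N] [IsNoetherian A N]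
    [Nontrivial A] (v : ℕ → N) : ∃ Q : A[X], Q.Monic ∧ substSeq v Q = 0 := by
  -- `L m` is the span of `v 0, …, v (m - 1)`. Once this chain is stationary, `v m` is a combination
  -- of earlier terms, which is a monic relation.
  let L : ℕ →o Submodule A N :=
    ⟨fun m => (Polynomial.degreeLT A m).map (substSeq v), fun m n hmn =>
      Submodule.map_mono (Polynomial.degreeLT_mono hmn)⟩
  obtain ⟨m, hm⟩ := monotone_stabilizes_iff_noetherian.mpr ‹IsNoetherian A N› L
  have hmem : v m ∈ L (m + 1) := by
    refine ⟨X ^ m, ?_, ?_⟩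
    · rw [SetLike.mem_coe, mem_degreeLT, degree_X_pow]
      exact_mod_cast Nat.lt_succ_self m
    · rw [X_pow_eq_monomial, substSeq_monomial, one_smul]
  rw [← hm (m + 1) (Nat.le_succ m)] at hmem
  obtain ⟨F, hF, hFv⟩ := hmem
  rw [SetLike.mem_coe, mem_degreeLT] at hF
  refine ⟨X ^ m - F, monic_X_pow_sub hF, ?_⟩
  rw [map_sub, hFv, X_pow_eq_monomial, substSeq_monomial, one_smul, sub_self]

/-- If the annihilators of a sequence in a Noetherian torsion-free module over a Noetherian
integrally closed domain form an ideal, then this ideal contains a monic polynomial of minimal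
degree. -/
theorem exists_monic_minimal_annihilator [IsDomain A] [IsIntegrallyClosed A]
    {N : Type*} [AddCommGroup N] [Module A N] [IsNoetherian A N] [Module.IsTorsionFree A N]
    (v : ℕ → N) (h : ∀ F : A[X], substSeq v F = 0 → substSeq v (X * F) = 0) :
    ∃ P : A[X], P.Monic ∧ substSeq v P = 0 ∧
      ∀ F : A[X], substSeq v F = 0 → F ≠ 0 → P.natDegree ≤ F.natDegree := by
  let K := FractionRing A
  -- This instance makes `algebraMap` and `Polynomial.map` definitionally equal, as `hmap` records.
  let _ : Algebra A[X] K[X] := Polynomial.algebra A K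
  have hmap : ∀ F : A[X], F.map (algebraMap A K) = algebraMap A[X] K[X] F := fun _ => rfl
  let I := annihilatingIdeal v h
  let J : Ideal K[X] := I.map (algebraMap A[X] K[X])
  obtain ⟨Q, hQm, hQ⟩ := exists_monic_substSeq_eq_zero (A := A) v
  let p : K[X] := Submodule.IsPrincipal.generator J
  have hJ : J = Ideal.span {p} := (Ideal.span_singleton_generator J).symm
  have hdvd : ∀ F : A[X], substSeq v F = 0 → p ∣ F.map (algebraMap A K) := fun F hF => by
    rw [← Ideal.mem_span_singleton, ← hJ, hmap]
    exact Ideal.mem_map_of_mem (algebraMap A[X] K[X]) (show F ∈ I from hF)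
  have hp0 : p ≠ 0 := by
    rintro h0
    have := hdvd Q hQ
    rw [h0, zero_dvd_iff] at this
    exact (hQm.map (algebraMap A K)).ne_zero this
  -- Gauss's lemma: a divisor over `K` of the monic `Q` has coefficients in `A`, up to its leading
  -- coefficient.
  obtain ⟨P, hP⟩ := IsIntegrallyClosed.eq_map_mul_C_of_dvd K hQm (hdvd Q hQ)
  have hc : IsUnit (C p.leadingCoeff : K[X]) :=
    isUnit_C.2 (isUnit_iff_ne_zero.2 (leadingCoeff_ne_zero.2 hp0))
  have hPp : Associated (P.map (algebraMap A K)) p := ⟨hc.unit, by simpa using hP⟩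
  have hinj : Function.Injective (algebraMap A K) := IsFractionRing.injective A K
  have hlead : (P.map (algebraMap A K)).leadingCoeff = 1 := by
    have := congrArg leadingCoeff hP
    rw [leadingCoeff_mul, leadingCoeff_C] at this
    exact mul_right_cancel₀ (leadingCoeff_ne_zero.2 hp0) (by rw [this, one_mul])
  have hPm : P.Monic := monic_of_injective hinj hlead
  refine ⟨P, hPm, ?_, fun F hF hF0 => ?_⟩
  -- `K[X]` is the localization of `A[X]` at the nonzero constants, so membership in `J` means that
  -- `d • P` annihilates `v` for some `d ≠ 0`; torsion-freeness removes `d`.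
  · have hPJ : P.map (algebraMap A K) ∈ J := by
      rw [hJ, Ideal.mem_span_singleton]
      exact hPp.dvd'
    have := Polynomial.isLocalization (nonZeroDivisors A) K
    rw [hmap,
      IsLocalization.algebraMap_mem_map_algebraMap_iff
        (Submonoid.map (C : A →+* A[X]) (nonZeroDivisors A))] at hPJ
    obtain ⟨_, ⟨d, hd, rfl⟩, hdP⟩ := hPJ
    have hz : substSeq v (C d * P) = 0 := mem_annihilatingIdeal.1 hdP
    rw [← smul_eq_C_mul, map_smul] at hz
    exact (smul_eq_zero.1 hz).resolve_left (nonZeroDivisors.ne_zero hd)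
  · have h1 : P.map (algebraMap A K) ∣ F.map (algebraMap A K) := hPp.dvd.trans (hdvd F hF)
    have h2 := natDegree_le_of_dvd h1 (by rwa [Ne, Polynomial.map_eq_zero_iff hinj])
    rwa [natDegree_map_eq_of_injective hinj, natDegree_map_eq_of_injective hinj] at h2

end Recurrence

/-! ### Skew operators -/

section Skew

open Polynomial

variable {W : Type*} [AddCommGroup W] [Module ℝ W]

/-- The inner product space core of a positive definite symmetric bilinear form. -/
@[reducible]
def formCore (B : W →ₗ[ℝ] W →ₗ[ℝ] ℝ) (hsymm : ∀ x y, B x y = B y x)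
    (hpos : ∀ x, x ≠ 0 → 0 < B x x) : InnerProductSpace.Core ℝ W where
  inner x y := B x y
  conj_inner_symm x y := by simp [hsymm y x]
  re_inner_nonneg x := by
    rcases eq_or_ne x 0 with rfl | hx
    · simp
    · exact (hpos x hx).le
  add_left x y z := by simp
  smul_left x y r := by simp
  definite x hx := by
    by_contra h
    exact (hpos x h).ne' hx

/-- The inner product stays local to the proof: the spaces to which this is applied already carry
norms unrelated to `B`. -/
theorem exists_orthonormal_basis_of_form [FiniteDimensional ℝ W] (B : W →ₗ[ℝ] W →ₗ[ℝ] ℝ)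
    (hsymm : ∀ x y, B x y = B y x) (hpos : ∀ x, x ≠ 0 → 0 < B x x) :
    ∃ b : Module.Basis (Fin (Module.finrank ℝ W)) ℝ W,
      ∀ i j, B (b i) (b j) = if i = j then 1 else 0 := by
  let c := formCore B hsymm hpos
  let _ : NormedAddCommGroup W := c.toNormedAddCommGroup
  let _ : InnerProductSpace ℝ W := InnerProductSpace.ofCore c.toCore
  refine ⟨(stdOrthonormalBasis ℝ W).toBasis, fun i j => ?_⟩
  have := orthonormal_iff_ite.1 (stdOrthonormalBasis ℝ W).orthonormal i j
  rw [OrthonormalBasis.coe_toBasis]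
  exact this

theorem exists_eigenbasis_of_form [FiniteDimensional ℝ W] (B : W →ₗ[ℝ] W →ₗ[ℝ] ℝ)
    (hsymm : ∀ x y, B x y = B y x) (hpos : ∀ x, x ≠ 0 → 0 < B x x) (T : W →ₗ[ℝ] W)
    (hT : ∀ x y, B (T x) y = B x (T y)) :
    ∃ (b : Module.Basis (Fin (Module.finrank ℝ W)) ℝ W) (μ : Fin (Module.finrank ℝ W) → ℝ),
      ∀ i, T (b i) = μ i • b i := by
  let c := formCore B hsymm hpos
  let _ : NormedAddCommGroup W := c.toNormedAddCommGroup
  let _ : InnerProductSpace ℝ W := InnerProductSpace.ofCore c.toCore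
  have hT' : T.IsSymmetric := hT
  refine ⟨(hT'.eigenvectorBasis rfl).toBasis, hT'.eigenvalues rfl, fun i => ?_⟩
  simp

/-- The adjoint of `S` is `-S`, so the adjoint of `q(S)` is `q(-S)`. -/
theorem form_aeval_skew (B : W →ₗ[ℝ] W →ₗ[ℝ] ℝ) (S : W →ₗ[ℝ] W)
    (hS : ∀ x y, B (S x) y = -B x (S y)) (q : ℝ[X]) (x y : W) :
    B (aeval S q x) y = B x (aeval S (q.comp (-X)) y) := by
  induction q using Polynomial.induction_on' generalizing x y with
  | add p q hp hq => simp [hp, hq]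
  | monomial n a =>
    have hpow : ∀ (n : ℕ) (x y : W), B ((S ^ n) x) y = B x (((-S) ^ n) y) := by
      intro n
      induction n with
      | zero => simp
      | succ n ih =>
        intro x y
        rw [pow_succ, pow_succ', Module.End.mul_apply, ih, Module.End.mul_apply, hS]
        simp
    simp [hpow, Algebra.algebraMap_eq_smul_one, ← C_mul_X_pow_eq_monomial]

theorem coeff_comp_neg_X (q : ℝ[X]) (j : ℕ) : (q.comp (-X)).coeff j = (-1) ^ j * q.coeff j := by
  rw [show (-X : ℝ[X]) = C (-1) * X by simp, comp_C_mul_X_coeff, mul_comm]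

/-- `r` is a product of factors `X + c` with `c > 0`. The induction also carries nonnegativity of
all coefficients, including those beyond the degree. -/
theorem coeff_pos_of_roots_neg {r : ℝ[X]} (hr : r.Monic) (hs : r.Splits)
    (hneg : ∀ a ∈ r.roots, a < 0) {i : ℕ} (hi : i ≤ r.natDegree) : 0 < r.coeff i := by
  have key : ∀ s : Multiset ℝ, (∀ a ∈ s, a < 0) →
      ((s.map fun a => X - C a).prod.natDegree = s.card) ∧
      (∀ i, 0 ≤ (s.map fun a => X - C a).prod.coeff i) ∧
      ∀ i ≤ s.card, 0 < (s.map fun a => X - C a).prod.coeff i := by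
    intro s
    induction s using Multiset.induction_on with
    | empty =>
      intro _
      refine ⟨by simp, fun i => ?_, fun i hi => ?_⟩
      · simp only [Multiset.map_zero, Multiset.prod_zero, coeff_one]
        split_ifs <;> norm_num
      · simp only [Multiset.card_zero, nonpos_iff_eq_zero] at hi
        simp [hi]
    | cons a s ih =>
      intro h
      obtain ⟨h1, h2, h3⟩ := ih fun b hb => h b (Multiset.mem_cons_of_mem hb)
      have ha := h a (Multiset.mem_cons_self a s)
      have hc : ∀ i, ((a ::ₘ s).map fun a => X - C a).prod.coeff i =
          (X * (s.map fun a => X - C a).prod).coeff i +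
            (-a) * (s.map fun a => X - C a).prod.coeff i := fun i => by
        rw [Multiset.map_cons, Multiset.prod_cons, sub_mul, coeff_sub, coeff_C_mul]
        ring
      refine ⟨natDegree_multiset_prod_X_sub_C_eq_card _, fun i => ?_, fun i hi => ?_⟩
      · rw [hc]
        refine add_nonneg ?_ (mul_nonneg (by linarith) (h2 i))
        cases i with
        | zero => simp
        | succ i => rw [coeff_X_mul]; exact h2 i
      · rw [hc]
        cases i with
        | zero =>
          rw [coeff_X_mul_zero, zero_add]
          exact mul_pos (by linarith) (h3 0 (Nat.zero_le _))
        | succ i =>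
          rw [coeff_X_mul]
          refine add_pos_of_pos_of_nonneg (h3 i ?_) (mul_nonneg (by linarith) (h2 _))
          rw [Multiset.card_cons] at hi
          omega
  have hprod := hs.eq_prod_roots_of_monic hr
  have := (key r.roots hneg).2.2 i (by rwa [← hs.natDegree_eq_card_roots])
  rwa [← hprod] at this

/-- The minimal annihilator of a vector under a skew operator contains only every other power, and
its coefficients are positive; if its degree is even, the vector is in the image. -/
theorem minimal_annihilator_of_skew [FiniteDimensional ℝ W] (B : W →ₗ[ℝ] W →ₗ[ℝ] ℝ)
    (hsymm : ∀ x y, B x y = B y x) (hpos : ∀ x, x ≠ 0 → 0 < B x x) (S : W →ₗ[ℝ] W)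
    (hS : ∀ x y, B (S x) y = -B x (S y)) (w : W) (p : ℝ[X]) (hp : p.Monic)
    (hpw : aeval S p w = 0)
    (hmin : ∀ q : ℝ[X], aeval S q w = 0 → q ≠ 0 → p.natDegree ≤ q.natDegree) :
    (∀ j ≤ p.natDegree, Odd (p.natDegree - j) → p.coeff j = 0) ∧
      (∀ i ≤ p.natDegree / 2, 0 < p.coeff (p.natDegree - 2 * i)) ∧
      (Even p.natDegree → ∃ w', w = S w') := by
  set k := p.natDegree with hk
  have hnonneg : ∀ x, 0 ≤ B x x := fun x => by
    rcases eq_or_ne x 0 with rfl | hx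
    · simp
    · exact (hpos x hx).le
  have hzero : ∀ x, B x x = 0 → x = 0 := fun x hx => by
    by_contra h
    exact (hpos x h).ne' hx
  have hlt : ∀ q : ℝ[X], aeval S q w = 0 → q.degree < k → q = 0 := fun q hq hd => by
    by_contra h
    have h1 := hmin q hq h
    rw [degree_eq_natDegree h] at hd
    exact absurd (Nat.cast_lt.1 hd) (not_lt.2 h1)
  have hcomm : aeval S p (aeval S (p.comp (-X)) w) = 0 := by
    rw [← Module.End.mul_apply, ← map_mul, mul_comm, map_mul, Module.End.mul_apply, hpw, map_zero]
  -- `B(p(-S)w, p(-S)w) = B(w, p(S)p(-S)w) = 0`, and `B` is definite.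
  have hrefl : aeval S (p.comp (-X)) w = 0 := by
    apply hzero
    rw [form_aeval_skew B S hS, comp_assoc]
    simp [hcomm]
  have hodd : ∀ j ≤ k, Odd (k - j) → p.coeff j = 0 := by
    -- Both `p(λ)` and `(-1)^k p(-λ)` are monic of degree `k` and annihilate `w`; by minimality
    -- their difference is zero.
    have hq : p - C ((-1) ^ k) * p.comp (-X) = 0 := by
      refine hlt _ (by simp [hpw, hrefl]) ?_
      rw [degree_lt_iff_coeff_zero]
      intro m hm
      rw [coeff_sub, coeff_C_mul, coeff_comp_neg_X]
      rcases hm.eq_or_lt with rfl | hm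
      · rw [show p.coeff k = 1 from hp, mul_one, ← mul_pow]
        simp
      · rw [coeff_eq_zero_of_natDegree_lt (hk ▸ hm)]
        simp
    intro j hj hjo
    have := congrArg (fun q => coeff q j) hq
    simp only [coeff_sub, coeff_C_mul, coeff_comp_neg_X, coeff_zero] at this
    have hs : ((-1 : ℝ)) ^ k * (-1) ^ j = -1 := by
      obtain ⟨m, hm⟩ : ∃ m, k = j + m := ⟨k - j, by omega⟩
      rw [hm, add_tsub_cancel_left] at hjo
      rw [hm, pow_add, mul_right_comm, ← mul_pow]
      simp [hjo.neg_one_pow]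
    rw [← mul_assoc, hs] at this
    linarith
  -- By parity, `p(λ) = λ^ε r(λ²)`. Then `r` is the minimal annihilator of `u = S^ε w` under the
  -- symmetric operator `T = S²`, whose eigenvalues are nonpositive.
  obtain ⟨ε, m, hε, hkm⟩ : ∃ ε m, ε ≤ 1 ∧ k = ε + 2 * m :=
    ⟨k % 2, k / 2, by omega, by omega⟩
  let r : ℝ[X] := ∑ i ∈ Finset.range (m + 1), C (p.coeff (ε + 2 * i)) * X ^ i
  have hrc : ∀ i ≤ m, r.coeff i = p.coeff (ε + 2 * i) := fun i hi => by
    simp only [r, finsetSum_coeff, coeff_C_mul_X_pow]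
    rw [Finset.sum_ite_eq, if_pos (Finset.mem_range.2 (by omega))]
  have hrc' : ∀ i, m < i → r.coeff i = 0 := fun i hi => by
    simp only [r, finsetSum_coeff, coeff_C_mul_X_pow]
    rw [Finset.sum_ite_eq, if_neg (by simp; omega)]
  have hrdeg : r.natDegree = m := by
    refine natDegree_eq_of_le_of_coeff_ne_zero (natDegree_le_iff_coeff_eq_zero.2 hrc') ?_
    rw [hrc m le_rfl, ← hkm, show p.coeff k = 1 from hp]
    exact one_ne_zero
  have hrm : r.Monic := by
    rw [Monic, leadingCoeff, hrdeg, hrc m le_rfl, ← hkm]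
    exact hp
  have hpr : p = X ^ ε * expand ℝ 2 r := by
    ext j
    rw [mul_comm, coeff_mul_X_pow']
    split_ifs with hj
    · rw [coeff_expand two_pos]
      split_ifs with hd
      · obtain ⟨i, hi⟩ := hd
        rw [hi, Nat.mul_div_cancel_left _ two_pos]
        by_cases him : i ≤ m
        · rw [hrc i him]
          congr 1
          omega
        · rw [hrc' i (by omega), coeff_eq_zero_of_natDegree_lt]
          omega
      · by_cases hjk : j ≤ k
        · refine hodd j hjk ?_
          rw [Nat.odd_iff]
          omega
        · exact coeff_eq_zero_of_natDegree_lt (by omega)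
    · refine hodd j (by omega) ?_
      rw [Nat.odd_iff]
      omega
  let T : W →ₗ[ℝ] W := S ^ 2
  let u : W := (S ^ ε) w
  have haev : ∀ s : ℝ[X], aeval S (X ^ ε * expand ℝ 2 s) w = aeval T s u := fun s => by
    rw [mul_comm, map_mul, Module.End.mul_apply, expand_aeval]
    simp [T, u]
  have hru : aeval T r u = 0 := by rw [← haev, ← hpr, hpw]
  have hminr : ∀ s : ℝ[X], aeval T s u = 0 → s.degree < m → s = 0 := by
    intro s hs hd
    by_contra h
    have h1 := hmin (X ^ ε * expand ℝ 2 s) (by rw [haev, hs])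
      (mul_ne_zero (pow_ne_zero _ X_ne_zero) ((expand_ne_zero two_pos).2 h))
    rw [natDegree_mul (pow_ne_zero _ X_ne_zero) ((expand_ne_zero two_pos).2 h), natDegree_X_pow,
      natDegree_expand] at h1
    rw [degree_eq_natDegree h, Nat.cast_lt] at hd
    omega
  have hTapp : ∀ x, T x = S (S x) := fun x => by simp [T, pow_two]
  have hTsymm : ∀ x y, B (T x) y = B x (T y) := fun x y => by
    rw [hTapp, hTapp, hS, hS, neg_neg]
  obtain ⟨b, μ, hb⟩ := exists_eigenbasis_of_form B hsymm hpos T hTsymm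
  have hμ : ∀ i, μ i ≤ 0 := fun i => by
    have h1 : B (T (b i)) (b i) = μ i * B (b i) (b i) := by rw [hb]; simp
    rw [hTapp, hS] at h1
    have h2 := hpos (b i) (b.ne_zero i)
    have h3 := hnonneg (S (b i))
    by_contra! h
    nlinarith [mul_pos h h2]
  let f : ℝ[X] := ∏ i, (X - C (μ i))
  have hf0 : f ≠ 0 := Finset.prod_ne_zero_iff.2 fun i _ => X_sub_C_ne_zero _
  have hfT : aeval T f = 0 := by
    refine b.ext fun i => ?_
    simp only [f]
    rw [← Finset.prod_erase_mul _ _ (Finset.mem_univ i), map_mul, Module.End.mul_apply]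
    simp [hb, Algebra.algebraMap_eq_smul_one]
  -- `f` annihilates `T`, so the remainder of `f` modulo `r` annihilates `u` and vanishes by
  -- minimality. Hence `r` splits, with roots among the `μ i`.
  have hrf : r ∣ f := by
    rw [← modByMonic_eq_zero_iff_dvd hrm]
    refine hminr _ ?_ ?_
    · rw [modByMonic_eq_sub_mul_div, map_sub, hfT, mul_comm, map_mul]
      simp [hru]
    · have := degree_modByMonic_lt f hrm
      rwa [degree_eq_natDegree hrm.ne_zero, hrdeg] at this
  have hfs : f.Splits := Splits.prod fun i _ => Splits.X_sub_C _
  have hrs : r.Splits := hfs.of_dvd hf0 hrf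
  -- If `r = X * s`, then `y = s(T)u` satisfies `S²y = 0`, and skewness forces `Sy = 0`. Thus `X *
  -- X^ε * s(X²)`, of degree `k - 1`, annihilates `w`.
  have hr0 : r.coeff 0 ≠ 0 := by
    intro h0
    obtain ⟨s, hs⟩ := X_dvd_iff.2 h0
    have hs0 : s ≠ 0 := by
      rintro rfl
      rw [mul_zero] at hs
      exact hrm.ne_zero hs
    have hsd : s.natDegree + 1 = m := by
      rw [← hrdeg, hs, natDegree_X_mul hs0]
    let y := aeval T s u
    have hTy : S (S y) = 0 := by
      rw [← hTapp]
      rw [hs, map_mul, Module.End.mul_apply, aeval_X] at hru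
      exact hru
    have hSy : S y = 0 := by
      apply hzero
      rw [hS, hTy, map_zero, neg_zero]
    have h1 := hmin (X * (X ^ ε * expand ℝ 2 s))
      (by rw [map_mul, Module.End.mul_apply, haev, aeval_X]; exact hSy)
      (mul_ne_zero X_ne_zero (mul_ne_zero (pow_ne_zero _ X_ne_zero)
        ((expand_ne_zero two_pos).2 hs0)))
    rw [natDegree_X_mul (mul_ne_zero (pow_ne_zero _ X_ne_zero) ((expand_ne_zero two_pos).2 hs0)),
      natDegree_mul (pow_ne_zero _ X_ne_zero) ((expand_ne_zero two_pos).2 hs0), natDegree_X_pow,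
      natDegree_expand] at h1
    omega
  have hneg : ∀ a ∈ r.roots, a < 0 := by
    intro a ha
    have har : r.eval a = 0 := (mem_roots hrm.ne_zero).1 ha
    have haf : f.eval a = 0 := eval_eq_zero_of_dvd_of_eval_eq_zero hrf har
    simp only [f, eval_prod, eval_sub, eval_X, eval_C] at haf
    obtain ⟨i, -, hi⟩ := Finset.prod_eq_zero_iff.1 haf
    refine lt_of_le_of_ne (by linarith [hμ i]) ?_
    rintro rfl
    exact hr0 (by rwa [← coeff_zero_eq_eval_zero] at har)
  have hevenpos : ∀ i ≤ k / 2, 0 < p.coeff (k - 2 * i) := by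
    intro i hi
    have h1 := coeff_pos_of_roots_neg hrm hrs hneg (i := m - i) (by omega)
    rw [hrc _ (by omega)] at h1
    convert h1 using 2
    omega
  refine ⟨hodd, hevenpos, fun hev => ?_⟩
  have hc : 0 < p.coeff 0 := by
    have := hevenpos (k / 2) le_rfl
    rwa [Nat.mul_div_cancel' hev.two_dvd, Nat.sub_self] at this
  -- With `p.coeff 0 ≠ 0`, the relation `p(S)w = 0` can be solved for `w`, which puts it in the
  -- image of `S`.
  have hw : S (aeval S p.divX w) + p.coeff 0 • w = 0 := by
    have := hpw
    rw [← p.divX_mul_X_add, mul_comm, map_add, map_mul, LinearMap.add_apply, Module.End.mul_apply,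
      aeval_X, aeval_C, Algebra.algebraMap_eq_smul_one] at this
    exact this
  refine ⟨-(p.coeff 0)⁻¹ • aeval S p.divX w, ?_⟩
  rw [map_smul, eq_neg_of_add_eq_zero_left hw, neg_smul, smul_neg, neg_neg, smul_smul,
    inv_mul_cancel₀ hc.ne', one_smul]

end Skew

/-! ### Minimal polynomials of jets generated by skew operators -/

section SkewJet

open Polynomial

variable {V W : Type*} [AddCommGroup V] [Module ℝ V] [AddCommGroup W] [Module ℝ W]

/-- Evaluation of polynomial functions at a vector. -/
def evalPoint (x : V) : PolyFun V →+* ℝ :=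
  (Pi.evalRingHom (fun _ : V => ℝ) x).comp (PolyFun V).subtype

theorem evalPoint_apply (x : V) (f : PolyFun V) : evalPoint x f = f.1 x := rfl

theorem polyFun_eq_zero_of_eq_zero_off_zeros {f h : PolyFun V} (hh : h ≠ 0)
    (H : ∀ x, h.1 x ≠ 0 → f.1 x = 0) : f = 0 := by
  refine Subtype.ext (funext fun x => le_antisymm ?_ ?_)
  · have := nonneg_of_nonneg_off_zeros (f := -f) hh (fun x hx => by simp [H x hx]) x
    simpa using this
  · exact nonneg_of_nonneg_off_zeros hh (fun x hx => (H x hx).ge) x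

theorem comp_smul_mem_polyFun (t : ℝ) {f : V → ℝ} (hf : f ∈ PolyFun V) :
    (fun x => f (t • x)) ∈ PolyFun V := by
  induction hf using Algebra.adjoin_induction with
  | mem _ hx =>
    obtain ⟨φ, rfl⟩ := hx
    exact dual_mem_polyFun (φ ∘ₗ (t • LinearMap.id))
  | algebraMap c => exact Subalgebra.algebraMap_mem _ c
  | add f g _ _ h₁ h₂ => exact add_mem h₁ h₂
  | mul f g _ _ h₁ h₂ => exact mul_mem h₁ h₂

theorem sum_range_smul_eq_aeval {r : ℕ → W} {S : W →ₗ[ℝ] W} (hr : ∀ j, r (j + 1) = S (r j))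
    (q : ℝ[X]) {n : ℕ} (hn : q.natDegree < n) :
    ∑ j ∈ Finset.range n, q.coeff j • r j = aeval S q (r 0) := by
  have hpow : ∀ j, r j = (S ^ j) (r 0) := fun j => by
    induction j with
    | zero => simp
    | succ j ih => rw [hr, ih, pow_succ', Module.End.mul_apply]
  rw [aeval_eq_sum_range' hn, LinearMap.sum_apply]
  exact Finset.sum_congr rfl fun j _ => by rw [hpow j, LinearMap.smul_apply]

theorem natDegree_ge_of_linearIndependent {r : ℕ → W} {S : W →ₗ[ℝ] W}
    (hr : ∀ j, r (j + 1) = S (r j)) {k : ℕ} (hk : LinearIndependent ℝ fun j : Fin k => r j)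
    {q : ℝ[X]} (hq : aeval S q (r 0) = 0) (hq0 : q ≠ 0) : k ≤ q.natDegree := by
  by_contra! hlt
  rw [← sum_range_smul_eq_aeval hr q hlt, Finset.sum_range fun j => q.coeff j • r j] at hq
  have := Fintype.linearIndependent_iff.1 hk _ hq ⟨q.natDegree, hlt⟩
  exact hq0 (leadingCoeff_eq_zero.1 this)

variable [FiniteDimensional ℝ V] [FiniteDimensional ℝ W]

/-- The algebraic core of the theorem, free of geometry: `r j` plays the role of `𝓡^j` and `S x`
that of the commutator with a skew endomorphism. No regularity of `S` in `x` is assumed. The last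
clause, with `τ` the trace, serves the Ricci statement. -/
theorem exists_minimal_polynomial_of_skew_jet (r : ℕ → V → W)
    (hpoly : ∀ j (φ : Module.Dual ℝ W), (fun x => φ (r j x)) ∈ PolyFun V)
    (hhom : ∀ j (t : ℝ) x, r j (t • x) = t ^ (j + 2) • r j x)
    (B : W →ₗ[ℝ] W →ₗ[ℝ] ℝ) (hsymm : ∀ x y, B x y = B y x) (hpos : ∀ x, x ≠ 0 → 0 < B x x)
    (S : V → W →ₗ[ℝ] W) (hS : ∀ x u v, B (S x u) v = -B u (S x v))
    (hr : ∀ j x, r (j + 1) x = S x (r j x)) :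
    ∃ P : (PolyFun V)[X], P.Monic ∧
      (∀ i ≤ P.natDegree, IsHomogeneousFun i (coeffFun P i)) ∧
      (∀ x, ∑ j ∈ Finset.range (P.natDegree + 1), (P.coeff j).1 x • r j x = 0) ∧
      (∃ x, LinearIndependent ℝ fun j : Fin P.natDegree => r j x) ∧
      (∀ Q : (PolyFun V)[X], Q.Monic →
        (∀ x, ∑ j ∈ Finset.range (Q.natDegree + 1), (Q.coeff j).1 x • r j x = 0) →
        (∃ x, LinearIndependent ℝ fun j : Fin Q.natDegree => r j x) → Q = P) ∧
      P = ∑ i ∈ Finset.range (P.natDegree / 2 + 1),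
        C (coeffFun P (2 * i)) * X ^ (P.natDegree - 2 * i) ∧
      (∀ i ≤ P.natDegree / 2, ∀ x, 0 ≤ (coeffFun P (2 * i)).1 x) ∧
      (∀ i ≤ P.natDegree / 2, ∀ x, (LinearIndependent ℝ fun j : Fin P.natDegree => r j x) →
        0 < (coeffFun P (2 * i)).1 x) ∧
      (∀ τ : Module.Dual ℝ W, (∀ x w, τ (S x w) = 0) → Even P.natDegree → ∀ x, τ (r 0 x) = 0) := by
  let b := Module.finBasis ℝ W
  let v : ℕ → Fin (Module.finrank ℝ W) → PolyFun V :=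
    fun j i => ⟨fun x => b.coord i (r j x), hpoly j (b.coord i)⟩
  have hsum : ∀ (F : (PolyFun V)[X]) x {n : ℕ}, F.natDegree < n →
      ∑ j ∈ Finset.range n, (F.coeff j).1 x • r j x =
        aeval (S x) (F.map (evalPoint x)) (r 0 x) := fun F x n hn => by
    rw [← sum_range_smul_eq_aeval (r := fun j => r j x) (fun j => hr j x) _
      (lt_of_le_of_lt natDegree_map_le hn)]
    exact Finset.sum_congr rfl fun j _ => by rw [coeff_map, evalPoint_apply]
  have hann : ∀ F : (PolyFun V)[X], substSeq v F = 0 ↔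
      ∀ x, aeval (S x) (F.map (evalPoint x)) (r 0 x) = 0 := fun F => by
    have h1 : ∀ i x, (substSeq v F i).1 x =
        b.coord i (aeval (S x) (F.map (evalPoint x)) (r 0 x)) := fun i x => by
      rw [← hsum F x (Nat.lt_succ_self _), substSeq_eq_sum_range v F (Nat.lt_succ_self _), map_sum,
        ← evalPoint_apply, Finset.sum_apply, map_sum]
      refine Finset.sum_congr rfl fun j _ => ?_
      rw [Pi.smul_apply, smul_eq_mul, map_mul, map_smul, smul_eq_mul]
      rfl
    constructor
    · intro h x
      refine b.ext_elem fun i => ?_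
      have := h1 i x
      rw [h] at this
      simpa using this.symm
    · intro h
      refine funext fun i => Subtype.ext (funext fun x => ?_)
      rw [h1, h x, map_zero]
      rfl
  -- Multiplying a relation by `λ` amounts to applying `S x` at each `x`, so annihilators form an
  -- ideal although `S` is not polynomial.
  obtain ⟨P, hPm, hPv, hPmin⟩ := exists_monic_minimal_annihilator v (fun F hF => by
    rw [hann] at hF ⊢
    intro x
    rw [Polynomial.map_mul, Polynomial.map_X, map_mul, Module.End.mul_apply, hF x, map_zero])
  set k := P.natDegree with hk
  have hPx : ∀ x, aeval (S x) (P.map (evalPoint x)) (r 0 x) = 0 := (hann P).1 hPv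
  have hPsum : ∀ x, ∑ j ∈ Finset.range (k + 1), (P.coeff j).1 x • r j x = 0 := fun x => by
    rw [hsum P x (Nat.lt_succ_self _), hPx x]
  -- The Gram determinant of the first `k` terms detects regularity.
  let Gm : Matrix (Fin k) (Fin k) (PolyFun V) := fun a c => ∑ i, v a i * v c i
  have hGm : ∀ x a c, (evalPoint x).mapMatrix Gm a c =
      ∑ i, b.coord i (r a x) * b.coord i (r c x) := fun x a c => by
    change evalPoint x (∑ i, v a i * v c i) = _
    rw [map_sum]
    rfl
  have hGreg : ∀ x, Gm.det.1 x ≠ 0 → LinearIndependent ℝ fun j : Fin k => r j x := by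
    intro x hx
    rw [← evalPoint_apply, RingHom.map_det] at hx
    rw [Fintype.linearIndependent_iff]
    intro c hc
    refine fun j => congrFun (Matrix.eq_zero_of_mulVec_eq_zero hx (v := c) ?_) j
    funext a
    simp only [Matrix.mulVec, dotProduct, hGm, Pi.zero_apply, Finset.sum_mul]
    rw [Finset.sum_comm]
    refine Finset.sum_eq_zero fun i _ => ?_
    have := congrArg (b.coord i) hc
    rw [map_sum, map_zero] at this
    simp only [map_smul, smul_eq_mul] at this
    calc ∑ j : Fin k, b.coord i (r a x) * b.coord i (r j x) * c j
        = b.coord i (r a x) * ∑ j : Fin k, c j * b.coord i (r j x) := by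
          rw [Finset.mul_sum]
          exact Finset.sum_congr rfl fun j _ => by ring
      _ = 0 := by rw [this, mul_zero]
  -- A kernel vector `c` of the Gram matrix gives `cᵀ Gm c = 0`, pointwise a sum of real squares.
  -- Hence `c` is a relation among `v 0, …, v (k - 1)`, contradicting the minimality of `k`.
  have hdet : Gm.det ≠ 0 := by
    intro h0
    obtain ⟨c, hc0, hc⟩ := Matrix.exists_mulVec_eq_zero_iff.2 h0
    have hzero : ∀ i x, ∑ j : Fin k, (c j).1 x * (v j i).1 x = 0 := by
      intro i x
      have h1 : ∑ i, (∑ j : Fin k, (c j).1 x * (v j i).1 x) ^ 2 = 0 := by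
        have h2 := congrArg (evalPoint x) (congrArg (fun z => c ⬝ᵥ z) hc)
        simp only [dotProduct_zero, map_zero] at h2
        rw [← h2]
        simp only [Matrix.mulVec, dotProduct, Gm, map_sum, map_mul, evalPoint_apply, pow_two,
          Finset.sum_mul, Finset.mul_sum]
        rw [Finset.sum_comm]
        refine Finset.sum_congr rfl fun j _ => ?_
        rw [Finset.sum_comm]
        refine Finset.sum_congr rfl fun l _ => ?_
        refine Finset.sum_congr rfl fun i _ => ?_
        ring
      exact pow_eq_zero_iff two_ne_zero |>.1
        ((Finset.sum_eq_zero_iff_of_nonneg fun i _ => sq_nonneg _).1 h1 i (Finset.mem_univ i))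
    let F : (PolyFun V)[X] := ∑ j : Fin k, monomial (j : ℕ) (c j)
    have hFc : ∀ j : Fin k, F.coeff j = c j := fun j => by
      simp only [F, finsetSum_coeff, coeff_monomial, Fin.val_inj]
      simp
    have hF0 : F ≠ 0 := by
      intro h
      refine hc0 (funext fun j => ?_)
      rw [← hFc, h, coeff_zero]
      rfl
    have hFv : substSeq v F = 0 := by
      simp only [F, map_sum, substSeq_monomial]
      refine funext fun i => Subtype.ext (funext fun x => ?_)
      rw [Finset.sum_apply, ← evalPoint_apply, map_sum]
      exact hzero i x
    have h1 := hPmin F hFv hF0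
    have h2 : F.degree < k := by
      refine (degree_sum_le _ _).trans_lt ((Finset.sup_lt_iff (WithBot.bot_lt_coe k)).2 fun j _ => ?_)
      exact (degree_monomial_le _ _).trans_lt (WithBot.coe_lt_coe.2 j.2)
    rw [degree_eq_natDegree hF0, Nat.cast_lt] at h2
    omega
  obtain ⟨x₀, hx₀⟩ : ∃ x, Gm.det.1 x ≠ 0 := by
    by_contra! hcon
    exact hdet (Subtype.ext (funext hcon))
  have hmap : ∀ x, (P.map (evalPoint x)).natDegree = k := fun x => hPm.natDegree_map _
  have hmapc : ∀ x j, (P.map (evalPoint x)).coeff j = (P.coeff j).1 x := fun x j => coeff_map _ _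
  have hskew : ∀ x, (LinearIndependent ℝ fun j : Fin k => r j x) → _ := fun x hx =>
    minimal_annihilator_of_skew B hsymm hpos (S x) (hS x) (r 0 x) (P.map (evalPoint x)) (hPm.map _)
      (hPx x) (fun q hq hq0 => (hmap x).trans_le (natDegree_ge_of_linearIndependent
        (r := fun j => r j x) (fun j => hr j x) hx hq hq0))
  simp only [hmap, hmapc] at hskew
  have hoddzero : ∀ j ≤ k, Odd (k - j) → P.coeff j = 0 := fun j hj ho =>
    polyFun_eq_zero_of_eq_zero_off_zeros hdet fun x hx => (hskew x (hGreg x hx)).1 j hj ho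
  refine ⟨P, hPm, ?_, hPsum, ⟨x₀, hGreg x₀ hx₀⟩, ?_, ?_, ?_, ?_, ?_⟩
  · intro i hi
    refine isHomogeneousFun_of_ne_zero fun t ht x => ?_
    let f : PolyFun V := ⟨fun x => (coeffFun P i).1 (t • x), comp_smul_mem_polyFun t (coeffFun P i).2⟩
      - t ^ i • coeffFun P i
    suffices hf : f = 0 by
      have := congrArg (fun f : PolyFun V => f.1 x) hf
      exact sub_eq_zero.1 this
    refine polyFun_eq_zero_of_eq_zero_off_zeros hdet fun x hx => ?_
    change (P.coeff (k - i)).1 (t • x) - t ^ i * (P.coeff (k - i)).1 x = 0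
    rcases Nat.eq_zero_or_pos i with rfl | hi0
    · rw [Nat.sub_zero, show P.coeff k = 1 from hPm]
      simp
    have h1 := hPsum (t • x)
    have h2 := congrArg (fun z => t ^ (k + 2) • z) (hPsum x)
    -- Subtracting the relation at `t • x` from `t^(k+2)` times the relation at `x` cancels the
    -- leading terms. Independence of the remaining `r j x` then compares coefficients at `j = k -
    -- i`, an index below `k` because `i > 0`.
    have h3 : ∑ j ∈ Finset.range (k + 1),
        (t ^ (k + 2) * (P.coeff j).1 x - t ^ (j + 2) * (P.coeff j).1 (t • x)) • r j x = 0 := by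
      have h4 := h2.trans (smul_zero _)
      rw [Finset.smul_sum] at h4
      refine Eq.trans ?_ ((congrArg₂ (· - ·) h4 h1).trans (sub_zero 0))
      rw [← Finset.sum_sub_distrib]
      refine Finset.sum_congr rfl fun j _ => ?_
      rw [hhom, smul_smul, smul_smul, ← sub_smul, mul_comm ((P.coeff j).1 (t • x))]
    rw [Finset.sum_range_succ, show P.coeff k = 1 from hPm] at h3
    simp only [OneMemClass.coe_one, Pi.one_apply, mul_one, sub_self, zero_smul, add_zero] at h3
    rw [Finset.sum_range fun j =>
      (t ^ (k + 2) * (P.coeff j).1 x - t ^ (j + 2) * (P.coeff j).1 (t • x)) • r j x] at h3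
    have h5 := Fintype.linearIndependent_iff.1 (hGreg x hx) _ h3 ⟨k - i, by omega⟩
    simp only at h5
    have h6 : t ^ (k + 2) = t ^ (k - i + 2) * t ^ i := by
      rw [← pow_add]
      congr 1
      omega
    rw [h6, mul_assoc, ← mul_sub] at h5
    have := (mul_eq_zero.1 h5).resolve_left (pow_ne_zero _ ht)
    linarith
  · rintro Q hQm hQ ⟨x, hx⟩
    have hQv : substSeq v Q = 0 := (hann Q).2 fun x => by
      rw [← hsum Q x (Nat.lt_succ_self _), hQ x]
    -- Minimality of `P` bounds `Q.natDegree` below, a regular point of `Q` bounds it above. The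
    -- difference of two monic annihilators of degree `k` has smaller degree, so it vanishes.
    have h1 : k ≤ Q.natDegree := hPmin Q hQv hQm.ne_zero
    have h2 := natDegree_ge_of_linearIndependent (r := fun j => r j x) (fun j => hr j x) hx (hPx x)
      (hPm.map _).ne_zero
    rw [hmap] at h2
    have hdeg : Q.degree = P.degree := by
      rw [degree_eq_natDegree hQm.ne_zero, degree_eq_natDegree hPm.ne_zero, le_antisymm h2 h1]
    by_contra hne
    have h3 := hPmin (Q - P) (by rw [map_sub, hQv, hPv, sub_zero]) (sub_ne_zero.2 hne)
    have h4 := degree_sub_lt_left hdeg hQm.ne_zero (by rw [hQm.leadingCoeff, hPm.leadingCoeff])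
    rw [hdeg, degree_eq_natDegree (sub_ne_zero.2 hne), degree_eq_natDegree hPm.ne_zero,
      Nat.cast_lt] at h4
    omega
  · ext1 j
    simp only [finsetSum_coeff, coeff_C_mul_X_pow, coeffFun, ← hk]
    by_cases hj : j ≤ k ∧ Even (k - j)
    · obtain ⟨hj, m, hm⟩ := hj
      rw [Finset.sum_eq_single m]
      · rw [if_pos (by omega)]
        congr 1
        omega
      · intro i hi hne
        rw [Finset.mem_range] at hi
        exact if_neg (by omega)
      · intro hm'
        rw [Finset.mem_range] at hm'
        omega
    · rw [Finset.sum_eq_zero]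
      · by_cases hjk : j ≤ k
        · exact hoddzero j hjk (Nat.not_even_iff_odd.1 fun h => hj ⟨hjk, h⟩)
        · exact coeff_eq_zero_of_natDegree_lt (by omega)
      · intro i hi
        rw [Finset.mem_range] at hi
        refine if_neg fun h => hj ⟨by omega, i, by omega⟩
  · exact fun i hi => nonneg_of_nonneg_off_zeros hdet fun x hx => ((hskew x (hGreg x hx)).2.1 i hi).le
  · exact fun i hi x hx => (hskew x hx).2.1 i hi
  · intro τ hτ hev x
    have : (⟨fun x => τ (r 0 x), hpoly 0 τ⟩ : PolyFun V) = 0 := by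
      refine polyFun_eq_zero_of_eq_zero_off_zeros hdet fun x hx => ?_
      obtain ⟨w', hw'⟩ := (hskew x (hGreg x hx)).2.2 hev
      change τ (r 0 x) = 0
      rw [hw', hτ]
    exact congrArg (fun f : PolyFun V => f.1 x) this

end SkewJet

/-! ### Regularity of the coordinate tensors -/

section CoordinateCalculus

variable {E : Type*} [NormedAddCommGroup E] [NormedSpace ℝ E] [FiniteDimensional ℝ E]

theorem contDiffAt_christoffel {G : E → E →L[ℝ] E →L[ℝ] ℝ} {x : E} (hG : ContDiffAt ℝ ∞ G x)
    (hx : (G x).IsInvertible) : ContDiffAt ℝ ∞ (christoffel G) x := by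
  have : CompleteSpace E := FiniteDimensional.complete ℝ E
  have hD : ContDiffAt ℝ ∞ (fderiv ℝ G) x := hG.fderiv_right (by simp)
  have hinv : ContDiffAt ℝ ∞ (fun y => (G y).inverse) x := hx.contDiffAt_map_inverse.comp x hG
  have hraise : ContDiffAt ℝ ∞ (fun y =>
      ContinuousLinearMap.compL ℝ E (E →L[ℝ] ℝ) E (G y).inverse) x :=
    (ContinuousLinearMap.compL ℝ E (E →L[ℝ] ℝ) E).contDiff.contDiffAt.comp x hinv
  have hA := hraise.clm_comp hD
  have hDflip : ContDiffAt ℝ ∞ (fun y => (fderiv ℝ G y).flip) x :=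
    (ContinuousLinearMap.flipₗᵢ ℝ E E (E →L[ℝ] ℝ)).contDiff.contDiffAt.comp x hD
  have hAflip := (ContinuousLinearMap.flipₗᵢ ℝ E E E).contDiff.contDiffAt.comp x hA
  have hB := hraise.clm_comp ((contDiffAt_const (c :=
    ((ContinuousLinearMap.flipₗᵢ ℝ E E ℝ).toContinuousLinearEquiv.toContinuousLinearMap :
      (E →L[ℝ] E →L[ℝ] ℝ) →L[ℝ] (E →L[ℝ] E →L[ℝ] ℝ)))).clm_comp hDflip)
  exact ((hA.add hAflip).sub hB).const_smul (2⁻¹ : ℝ)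

theorem contDiffAt_curvature {G : E → E →L[ℝ] E →L[ℝ] ℝ} {x : E} (hG : ContDiffAt ℝ ∞ G x)
    (hx : (G x).IsInvertible) : ContDiffAt ℝ ∞ (curvature G) x := by
  have hΓ := contDiffAt_christoffel hG hx
  have hD : ContDiffAt ℝ ∞ (fderiv ℝ (christoffel G)) x := hΓ.fderiv_right (by simp)
  have hS : ContDiffAt ℝ ∞ (fun y => fderiv ℝ (christoffel G) y +
      (ContinuousLinearMap.compL ℝ E E E).bilinearComp (christoffel G y) (christoffel G y)) x := by
    refine hD.add ?_
    have h1 : ContDiffAt ℝ ∞ (fun y =>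
        ((ContinuousLinearMap.compL ℝ E E E).comp (christoffel G y)).flip) x :=
      (ContinuousLinearMap.flipₗᵢ ℝ E (E →L[ℝ] E) (E →L[ℝ] E)).contDiff.contDiffAt.comp x
        (contDiffAt_const.clm_comp hΓ)
    exact (ContinuousLinearMap.flipₗᵢ ℝ E E (E →L[ℝ] E)).contDiff.contDiffAt.comp x
      (h1.clm_comp hΓ)
  exact hS.sub ((ContinuousLinearMap.flipₗᵢ ℝ E E (E →L[ℝ] E)).contDiff.contDiffAt.comp x hS)

/-- Uncurrying of trilinear maps. -/
def uncurryThree : (E →L[ℝ] E →L[ℝ] E →L[ℝ] E) →ₗ[ℝ]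
    ContinuousMultilinearMap ℝ (fun _ : Fin 3 => E) E where
  toFun c :=
    { toFun := fun v => c (v 0) (v 1) (v 2)
      map_update_add' := by
        intro inst v i a b
        obtain rfl := Subsingleton.elim inst (instDecidableEqFin 3)
        obtain rfl | rfl | rfl : i = 0 ∨ i = 1 ∨ i = 2 := by omega
        all_goals simp
      map_update_smul' := by
        intro inst v i c a
        obtain rfl := Subsingleton.elim inst (instDecidableEqFin 3)
        obtain rfl | rfl | rfl : i = 0 ∨ i = 1 ∨ i = 2 := by omega
        all_goals simp
      cont := by fun_prop }
  map_add' _ _ := rfl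
  map_smul' _ _ := rfl

theorem contDiffAt_curvatureTensor {G : E → E →L[ℝ] E →L[ℝ] ℝ} {x : E} (hG : ContDiffAt ℝ ∞ G x)
    (hx : (G x).IsInvertible) : ContDiffAt ℝ ∞ (curvatureTensor G) x :=
  (LinearMap.toContinuousLinearMap (uncurryThree (E := E))).contDiff.contDiffAt.comp x
    (contDiffAt_curvature hG hx)

theorem contDiffAt_covDeriv {m : ℕ} {G : E → E →L[ℝ] E →L[ℝ] ℝ} {x : E}
    (hG : ContDiffAt ℝ ∞ G x) (hx : (G x).IsInvertible)
    {T : E → ContinuousMultilinearMap ℝ (fun _ : Fin m => E) E} (hT : ContDiffAt ℝ ∞ T x) :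
    ContDiffAt ℝ ∞ (covDeriv G T) x := by
  have hΓ := contDiffAt_christoffel hG hx
  have hD : ContDiffAt ℝ ∞ (fderiv ℝ T) x := hT.fderiv_right (by simp)
  have h1 : ContDiffAt ℝ ∞ (fun y => ((ContinuousLinearMap.compContinuousMultilinearMapL ℝ
      (fun _ : Fin m => E) E E).flip (T y)).comp (christoffel G y)) x :=
    (((ContinuousLinearMap.compContinuousMultilinearMapL ℝ
      (fun _ : Fin m => E) E E).flip).contDiff.contDiffAt.comp x hT).clm_comp hΓ
  have h2 : ContDiffAt ℝ ∞ (fun y => (slotAction (T y)).comp (christoffel G y)) x := by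
    refine ContDiffAt.clm_comp ?_ hΓ
    simp only [slotAction]
    refine ContDiffAt.sum fun i _ => ?_
    exact (ContinuousLinearMap.contDiff _).contDiffAt.comp x hT
  exact (continuousMultilinearCurryLeftEquiv ℝ
    (fun _ : Fin (m + 1) => E) E).symm.contDiff.contDiffAt.comp x ((hD.add h1).sub h2)

theorem contDiffAt_iteratedCovDerivCurvature {G : E → E →L[ℝ] E →L[ℝ] ℝ} {x : E}
    (hG : ContDiffAt ℝ ∞ G x) (hx : (G x).IsInvertible) (k : ℕ) :
    ContDiffAt ℝ ∞ (iteratedCovDerivCurvature G k) x := by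
  induction k with
  | zero => exact contDiffAt_curvatureTensor hG hx
  | succ k ih => exact contDiffAt_covDeriv hG hx ih

theorem differentiableAt_of_apply {F : Type*} [NormedAddCommGroup F] [NormedSpace ℝ F]
    {A : ℝ → E →L[ℝ] F} {t : ℝ} (h : ∀ Y, DifferentiableAt ℝ (fun s => A s Y) t) :
    DifferentiableAt ℝ A t := by
  let d := Module.finBasis ℝ E
  have hA : A = fun s => ∑ i, ContinuousLinearMap.smulRightL ℝ E F
      (LinearMap.toContinuousLinearMap (d.coord i)) (A s (d i)) := by
    funext s
    ext Y
    conv_lhs => rw [← d.sum_repr Y]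
    simp [-Module.Basis.sum_repr]
  rw [hA]
  exact DifferentiableAt.fun_sum fun i _ =>
    (ContinuousLinearMap.differentiableAt _).comp t (h (d i))

omit [FiniteDimensional ℝ E] in
theorem symCurvatureCoord_apply (G : E → E →L[ℝ] E →L[ℝ] ℝ) (k : ℕ) (x X Y : E) :
    symCurvatureCoord G k x X Y = iteratedCovDerivCurvature G k x
      (Function.update (fun _ => X) ⟨k, by omega⟩ Y) := rfl

/-- Along a geodesic the covariant derivative of `𝓡^k(c')` is `𝓡^{k+1}(c')`. -/
theorem covDerivAlong_symCurvatureCoord {G : E → E →L[ℝ] E →L[ℝ] ℝ} {c : ℝ → E} {t : ℝ}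
    (hG : ContDiffAt ℝ ∞ G (c t)) (hx : (G (c t)).IsInvertible) (hc : DifferentiableAt ℝ c t)
    (hgeo : HasDerivAt (deriv c) (-christoffel G (c t) (deriv c t) (deriv c t)) t) (k : ℕ) :
    DifferentiableAt ℝ (fun s => symCurvatureCoord G k (c s) (deriv c s)) t ∧
    covDerivAlong G c (fun s => symCurvatureCoord G k (c s) (deriv c s)) t =
      symCurvatureCoord G (k + 1) (c t) (deriv c t) := by
  classical
  set v := deriv c t with hv
  set a := -christoffel G (c t) v v with ha
  let T := iteratedCovDerivCurvature G k
  let κ : Fin (k + 3) := ⟨k, by omega⟩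
  have hT : DifferentiableAt ℝ T (c t) :=
    (contDiffAt_iteratedCovDerivCurvature hG hx k).differentiableAt (by simp)
  have hTc : HasFDerivAt (fun s => T (c s))
      (ContinuousLinearMap.toSpanSingleton ℝ (fderiv ℝ T (c t) v)) t :=
    (hT.hasFDerivAt.comp_hasDerivAt t hc.hasDerivAt).hasFDerivAt
  -- Product rule: slot `κ` holds the constant `Y`, every other slot holds `c'`, whose derivative is
  -- `a = -Γ(v, v)` by the geodesic equation.
  have hderiv : ∀ Y, HasDerivAt (fun s => symCurvatureCoord G k (c s) (deriv c s) Y)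
      (fderiv ℝ T (c t) v (Function.update (fun _ => v) κ Y) +
        ∑ i, T (c t) (Function.update (Function.update (fun _ => v) κ Y) i
          (if i = κ then 0 else a))) t := by
    intro Y
    have hg : ∀ i : Fin (k + 3), HasFDerivAt
        (fun s => Function.update (fun _ => deriv c s) κ Y i)
        (ContinuousLinearMap.toSpanSingleton ℝ (if i = κ then 0 else a)) t := by
      intro i
      by_cases hi : i = κ
      · subst hi
        simp only [Function.update_self, if_true]
        exact (hasDerivAt_const t Y).hasFDerivAt
      · simp only [Function.update_of_ne hi, if_neg hi]
        exact hgeo.hasFDerivAt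
    have h := (hTc.continuousMultilinearMap_apply hg).hasDerivAt
    convert h using 1
    · rfl
    · simp only [← hv, add_apply, ContinuousLinearMap.comp_apply,
        sum_apply, ContinuousLinearMap.toSpanSingleton_apply, one_smul]
      rfl
  have hdiff : DifferentiableAt ℝ (fun s => symCurvatureCoord G k (c s) (deriv c s)) t :=
    differentiableAt_of_apply fun Y => (hderiv Y).differentiableAt
  refine ⟨hdiff, ?_⟩
  ext Y
  have hY := (hdiff.hasDerivAt.clm_apply (hasDerivAt_const t Y)).unique (hderiv Y)
  rw [map_zero, add_zero] at hY
  have hlhs : covDerivAlong G c (fun s => symCurvatureCoord G k (c s) (deriv c s)) t Y =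
      deriv (fun s => symCurvatureCoord G k (c s) (deriv c s)) t Y
        + christoffel G (c t) v (T (c t) (Function.update (fun _ => v) κ Y))
        - T (c t) (Function.update (fun _ => v) κ (christoffel G (c t) v Y)) := rfl
  rw [hlhs, hY]
  have htail : Fin.tail (Function.update (fun _ : Fin (k + 1 + 3) => v) ⟨k + 1, by omega⟩ Y) =
      Function.update (fun _ : Fin (k + 3) => v) κ Y :=
    Fin.tail_update_succ (fun _ : Fin (k + 3 + 1) => v) κ Y
  have hhead : Function.update (fun _ : Fin (k + 1 + 3) => v) ⟨k + 1, by omega⟩ Y 0 = v :=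
    Function.update_of_ne (by simp [Fin.ext_iff]) _ _
  rw [symCurvatureCoord_apply]
  change _ = covDeriv G T (c t) _
  rw [covDeriv_apply, htail, hhead, add_right_comm, add_sub_assoc, sub_eq_add_neg, sub_eq_add_neg,
    add_right_inj]
  -- Slot `κ` is separated: its term `T(…, Γ(v, Y), …)` matches the one coming from `A ∘ Γ`. In the
  -- other slots the derivative `a` matches the correction `-Γ(v, v)`.
  rw [← Finset.add_sum_erase _ _ (Finset.mem_univ κ), ← Finset.add_sum_erase _
    (fun i => T (c t) (Function.update (Function.update (fun _ => v) κ Y) i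
      (christoffel G (c t) v (Function.update (fun _ => v) κ Y i)))) (Finset.mem_univ κ)]
  simp only [if_true, Function.update_idem, Function.update_self]
  rw [(T (c t)).map_coord_zero κ (by simp), zero_add, neg_add, add_comm, add_right_inj,
    ← Finset.sum_neg_distrib]
  refine Finset.sum_congr rfl fun i hi => ?_
  have hi' : i ≠ κ := Finset.ne_of_mem_erase hi
  rw [if_neg hi', Function.update_of_ne hi', ha]
  exact (T (c t)).toMultilinearMap.map_update_neg _ _ _

/-- Existence of geodesics in coordinates. -/
theorem exists_geodesic_coord {G : E → E →L[ℝ] E →L[ℝ] ℝ} {Ω : Set E} (hΩ : IsOpen Ω)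
    (hG : ∀ x ∈ Ω, ContDiffAt ℝ ∞ G x) (hinv : ∀ x ∈ Ω, (G x).IsInvertible) {x₀ : E}
    (hx₀ : x₀ ∈ Ω) (v₀ : E) :
    ∃ c : ℝ → E, ∃ ε > 0, c 0 = x₀ ∧ deriv c 0 = v₀ ∧ ContDiffOn ℝ 2 c (Set.Ioo (-ε) ε) ∧
      ∀ t ∈ Set.Ioo (-ε) ε, c t ∈ Ω ∧ DifferentiableAt ℝ c t ∧
        HasDerivAt (deriv c) (-christoffel G (c t) (deriv c t) (deriv c t)) t := by
  have : CompleteSpace E := FiniteDimensional.complete ℝ E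
  -- The geodesic equation as a first-order system for position and velocity.
  let F : E × E → E × E := fun z => (z.2, -christoffel G z.1 z.2 z.2)
  have hF : ContDiffAt ℝ 1 F (x₀, v₀) := by
    have h1 : ContDiffAt ℝ ∞ (fun z : E × E => christoffel G z.1) (x₀, v₀) :=
      ContDiffAt.comp (x₀, v₀) (contDiffAt_christoffel (hG x₀ hx₀) (hinv x₀ hx₀)) contDiffAt_fst
    exact (contDiffAt_snd.prodMk
      ((h1.clm_apply contDiffAt_snd).clm_apply contDiffAt_snd).neg).of_le (by simp)
  obtain ⟨α, hα0, ε, hε, hα⟩ :=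
    hF.exists_forall_mem_closedBall_exists_eq_forall_mem_Ioo_hasDerivAt₀ 0
  have hcont : ContinuousAt α 0 := (hα 0 (by simp [hε])).continuousAt
  have hnear : ∀ᶠ t in nhds (0 : ℝ), (α t).1 ∈ Ω :=
    (continuous_fst.continuousAt.comp hcont).eventually
      (hΩ.mem_nhds (by simpa [hα0] using hx₀))
  obtain ⟨δ, hδ, hδΩ⟩ := Metric.eventually_nhds_iff.1 hnear
  let η := min ε δ
  have hη : 0 < η := lt_min hε hδ
  have hαη : ∀ t ∈ Set.Ioo (-η) η, HasDerivAt α (F (α t)) t := fun t ht => by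
    refine hα t ⟨?_, ?_⟩
    · linarith [ht.1, min_le_left ε δ]
    · linarith [ht.2, min_le_left ε δ]
  let c : ℝ → E := fun t => (α t).1
  have hc : ∀ t ∈ Set.Ioo (-η) η, HasDerivAt c (α t).2 t := fun t ht =>
    (ContinuousLinearMap.fst ℝ E E).hasFDerivAt.comp_hasDerivAt t (hαη t ht)
  have hdc : ∀ t ∈ Set.Ioo (-η) η, deriv c t = (α t).2 := fun t ht => (hc t ht).deriv
  have hddc : ∀ t ∈ Set.Ioo (-η) η,
      HasDerivAt (deriv c) (-christoffel G (c t) (deriv c t) (deriv c t)) t := fun t ht => by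
    rw [hdc t ht]
    have h1 : HasDerivAt (fun s => (α s).2) (-christoffel G (c t) (α t).2 (α t).2) t :=
      (ContinuousLinearMap.snd ℝ E E).hasFDerivAt.comp_hasDerivAt t (hαη t ht)
    refine h1.congr_of_eventuallyEq ?_
    filter_upwards [isOpen_Ioo.mem_nhds ht] with s hs using hdc s hs
  have hcΩ : ∀ t ∈ Set.Ioo (-η) η, c t ∈ Ω := fun t ht => by
    refine hδΩ ?_
    rw [Real.dist_eq, sub_zero, abs_lt]
    constructor <;> linarith [ht.1, ht.2, min_le_right ε δ]
  have h0 : (0 : ℝ) ∈ Set.Ioo (-η) η := ⟨by linarith, hη⟩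
  refine ⟨c, η, hη, by simp [c, hα0], by rw [hdc 0 h0, hα0], ?_, fun t ht =>
    ⟨hcΩ t ht, (hc t ht).differentiableAt, hddc t ht⟩⟩
  rw [show (2 : WithTop ℕ∞) = 1 + 1 from rfl, contDiffOn_succ_iff_deriv_of_isOpen isOpen_Ioo]
  refine ⟨fun t ht => (hc t ht).differentiableAt.differentiableWithinAt, by simp, ?_⟩
  rw [show (1 : WithTop ℕ∞) = 0 + 1 from rfl, contDiffOn_succ_iff_deriv_of_isOpen isOpen_Ioo]
  refine ⟨fun t ht => (hddc t ht).differentiableAt.differentiableWithinAt, by simp, ?_⟩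
  rw [contDiffOn_zero]
  intro t ht
  have h1 : ContinuousAt (fun s => -christoffel G (c s) (deriv c s) (deriv c s)) t := by
    have h2 : ContinuousAt (fun s => christoffel G (c s)) t :=
      ContinuousAt.comp (g := christoffel G)
        (contDiffAt_christoffel (hG _ (hcΩ t ht)) (hinv _ (hcΩ t ht))).continuousAt
        (hc t ht).continuousAt
    have h3 : ContinuousAt (deriv c) t := (hddc t ht).continuousAt
    exact ((h2.clm_apply h3).clm_apply h3).neg
  refine (h1.congr ?_).continuousWithinAt
  filter_upwards [isOpen_Ioo.mem_nhds ht] with s hs using (hddc s hs).deriv.symm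

end CoordinateCalculus

/-! ### Symmetries of the curvature tensor -/

section Symmetries

variable {E : Type*} [NormedAddCommGroup E] [NormedSpace ℝ E]

theorem fderiv_symm_of_symm {G : E → E →L[ℝ] E →L[ℝ] ℝ} {x : E} (hG : DifferentiableAt ℝ G x)
    (hsymm : ∀ᶠ y in nhds x, ∀ u v, G y u v = G y v u) (u v w : E) :
    fderiv ℝ G x u v w = fderiv ℝ G x u w v := by
  have h : ∀ v w, HasFDerivAt (fun y => G y v w) _ x := fun v w =>
    (hG.hasFDerivAt.clm_apply (hasFDerivAt_const v x)).clm_apply (hasFDerivAt_const w x)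
  have h1 := (h v w).congr_of_eventuallyEq (f₁ := fun y => G y w v)
    (hsymm.mono fun y hy => hy w v)
  simpa using DFunLike.congr_fun (h1.unique (h w v)) u

theorem christoffel_comm {G : E → E →L[ℝ] E →L[ℝ] ℝ} {x : E}
    (hD : ∀ u v w, fderiv ℝ G x u v w = fderiv ℝ G x u w v) (u v : E) :
    christoffel G x u v = christoffel G x v u := by
  rw [christoffel_apply, christoffel_apply]
  congr 2
  ext w
  simp [hD w u v, add_comm]

/-- Metric compatibility of the connection: adding the two Koszul formulas cancels all but one
derivative. -/
theorem fderiv_metric_eq {G : E → E →L[ℝ] E →L[ℝ] ℝ} {x : E} (hinv : (G x).IsInvertible)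
    (hs : ∀ u v, G x u v = G x v u)
    (hD : ∀ u v w, fderiv ℝ G x u v w = fderiv ℝ G x u w v) (u v w : E) :
    fderiv ℝ G x u v w = G x (christoffel G x u v) w + G x v (christoffel G x u w) := by
  rw [hs v, apply_christoffel G x u v w hinv, apply_christoffel G x u w v hinv, hD u w v]
  ring

/-- Torsion-freeness near `x` makes both `Γ` and its derivative symmetric, and the cyclic sum
cancels in pairs. -/
theorem curvature_bianchi {G : E → E →L[ℝ] E →L[ℝ] ℝ} {x : E}
    (hΓd : DifferentiableAt ℝ (christoffel G) x)
    (hΓ : ∀ᶠ y in nhds x, ∀ u v, christoffel G y u v = christoffel G y v u) (u v w : E) :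
    curvature G x u v w + curvature G x v w u + curvature G x w u v = 0 := by
  have h : ∀ v w, HasFDerivAt (fun y => christoffel G y v w) _ x := fun v w =>
    (hΓd.hasFDerivAt.clm_apply (hasFDerivAt_const v x)).clm_apply (hasFDerivAt_const w x)
  have hD : ∀ u v w, fderiv ℝ (christoffel G) x u v w = fderiv ℝ (christoffel G) x u w v :=
    fun u v w => by
      have h1 := (h v w).congr_of_eventuallyEq (f₁ := fun y => christoffel G y w v)
        (hΓ.mono fun y hy => hy w v)
      simpa using DFunLike.congr_fun (h1.unique (h w v)) u
  have hx := hΓ.self_of_nhds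
  simp only [curvature_apply]
  rw [hD u w v, hD v w u, hD w v u, hx w v, hx u w, hx v u]
  abel

variable [FiniteDimensional ℝ E]

/-- Differentiating metric compatibility expresses the second derivative of `G` through `Γ` and its
derivative; the symmetry of that second derivative in `a, u` is the claim. -/
theorem curvature_skew {G : E → E →L[ℝ] E →L[ℝ] ℝ} {x : E} (hG : ContDiffAt ℝ ∞ G x)
    (hinv : ∀ᶠ y in nhds x, (G y).IsInvertible)
    (hsymm : ∀ᶠ y in nhds x, ∀ u v, G y u v = G y v u) (a u v w : E) :
    G x (curvature G x a u v) w = -G x v (curvature G x a u w) := by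
  have hΓd : DifferentiableAt ℝ (christoffel G) x :=
    (contDiffAt_christoffel hG hinv.self_of_nhds).differentiableAt (by simp)
  have hGd : DifferentiableAt ℝ G x := hG.differentiableAt (by simp)
  have hDd : DifferentiableAt ℝ (fderiv ℝ G) x :=
    (hG.fderiv_right (m := ∞) (by simp)).differentiableAt (by simp)
  have hGev : ∀ᶠ y in nhds x, ContDiffAt ℝ 1 G y :=
    (hG.of_le (m := 1) (by simp)).eventually (by simp)
  have hcompat : ∀ u v w, ∀ᶠ y in nhds x, fderiv ℝ G y u v w =
      G y (christoffel G y u v) w + G y v (christoffel G y u w) := fun u v w => by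
    filter_upwards [hinv, hsymm, hsymm.eventually_nhds, hGev] with y h1 h2 h3 h4
    exact fderiv_metric_eq h1 h2 (fderiv_symm_of_symm (h4.differentiableAt (by simp)) h3) u v w
  have hdiff : ∀ a u v w, fderiv ℝ (fderiv ℝ G) x a u v w =
      fderiv ℝ G x a (christoffel G x u v) w + G x (fderiv ℝ (christoffel G) x a u v) w +
      (fderiv ℝ G x a v (christoffel G x u w) + G x v (fderiv ℝ (christoffel G) x a u w)) := by
    intro a u v w
    have hl := ((hDd.hasFDerivAt.clm_apply (hasFDerivAt_const u x)).clm_apply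
      (hasFDerivAt_const v x)).clm_apply (hasFDerivAt_const w x)
    have hΓu : ∀ z, HasFDerivAt (fun y => christoffel G y u z) _ x := fun z =>
      (hΓd.hasFDerivAt.clm_apply (hasFDerivAt_const u x)).clm_apply (hasFDerivAt_const z x)
    have hr := ((hGd.hasFDerivAt.clm_apply (hΓu v)).clm_apply (hasFDerivAt_const w x)).add
      ((hGd.hasFDerivAt.clm_apply (hasFDerivAt_const v x)).clm_apply (hΓu w))
    have := DFunLike.congr_fun ((hl.congr_of_eventuallyEq
      ((hcompat u v w).mono fun y hy => hy.symm)).unique hr) a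
    simp at this
    linarith
  have hsecond : fderiv ℝ (fderiv ℝ G) x a u = fderiv ℝ (fderiv ℝ G) x u a :=
    (hG.isSymmSndFDerivAt (by
      rw [minSmoothness_of_isRCLikeNormedField]
      exact WithTop.coe_le_coe.2 (le_top : (2 : ℕ∞) ≤ ⊤))).eq a u
  have hc := fun u v w => (hcompat u v w).self_of_nhds
  have h1 := hdiff a u v w
  have h2 := hdiff u a v w
  rw [hsecond, h2, hc, hc, hc, hc] at h1
  rw [curvature_apply, curvature_apply]
  simp only [map_add, map_sub, add_apply, sub_apply]
  linarith

theorem trace_eq_zero_of_skew (B : E →ₗ[ℝ] E →ₗ[ℝ] ℝ) (hsymm : ∀ x y, B x y = B y x)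
    (hpos : ∀ x, x ≠ 0 → 0 < B x x) (A : E →ₗ[ℝ] E) (hA : ∀ x y, B (A x) y = -B x (A y)) :
    LinearMap.trace ℝ E A = 0 := by
  obtain ⟨b, hb⟩ := exists_orthonormal_basis_of_form B hsymm hpos
  rw [LinearMap.trace_eq_matrix_trace ℝ b, Matrix.trace]
  refine Finset.sum_eq_zero fun i _ => ?_
  rw [Matrix.diag_apply, LinearMap.toMatrix_apply]
  have h1 : b.repr (A (b i)) i = B (A (b i)) (b i) := by
    conv_rhs => rw [← b.sum_repr (A (b i))]
    simp [-Module.Basis.sum_repr, hb]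
  have h2 := hA (b i) (b i)
  rw [hsymm (b i)] at h2
  rw [h1]
  linarith

/-- The Ricci tensor is symmetric. -/
theorem trace_curvature_comm {G : E → E →L[ℝ] E →L[ℝ] ℝ} {x : E} (hG : ContDiffAt ℝ ∞ G x)
    (hinv : ∀ᶠ y in nhds x, (G y).IsInvertible)
    (hsymm : ∀ᶠ y in nhds x, ∀ u v, G y u v = G y v u) (hpos : ∀ v, v ≠ 0 → 0 < G x v v)
    (X Y : E) :
    LinearMap.trace ℝ E (((curvature G x).flip X).flip Y : E →L[ℝ] E).toLinearMap =
      LinearMap.trace ℝ E (((curvature G x).flip Y).flip X : E →L[ℝ] E).toLinearMap := by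
  have hΓd : DifferentiableAt ℝ (christoffel G) x :=
    (contDiffAt_christoffel hG hinv.self_of_nhds).differentiableAt (by simp)
  have hGev : ∀ᶠ y in nhds x, ContDiffAt ℝ 1 G y :=
    (hG.of_le (m := 1) (by simp)).eventually (by simp)
  have hΓ : ∀ᶠ y in nhds x, ∀ u v, christoffel G y u v = christoffel G y v u := by
    filter_upwards [hsymm.eventually_nhds, hGev] with y h3 h4
    exact christoffel_comm (fderiv_symm_of_symm (h4.differentiableAt (by simp)) h3)
  -- By the Bianchi identity the two endomorphisms differ by `-R(X, Y)`, which is skew and so has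
  -- trace zero.
  have hR : (((curvature G x).flip X).flip Y : E →L[ℝ] E).toLinearMap -
      (((curvature G x).flip Y).flip X : E →L[ℝ] E).toLinearMap =
      -(curvature G x X Y).toLinearMap := by
    ext Z
    change curvature G x Z X Y - curvature G x Z Y X = -curvature G x X Y Z
    have h1 := curvature_bianchi hΓd hΓ Z X Y
    have h2 : curvature G x Y Z X = -curvature G x Z Y X := by
      rw [curvature_apply, curvature_apply]
      abel
    rw [h2] at h1
    rw [eq_neg_iff_add_eq_zero, sub_eq_add_neg, add_right_comm]
    exact h1
  let B : E →ₗ[ℝ] E →ₗ[ℝ] ℝ := (ContinuousLinearMap.coeLM ℝ).comp (G x).toLinearMap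
  have h0 := trace_eq_zero_of_skew B hsymm.self_of_nhds hpos (curvature G x X Y).toLinearMap
    fun v w => curvature_skew hG hinv hsymm X Y v w
  rw [← sub_eq_zero, ← map_sub, hR, map_neg, h0, neg_zero]

end Symmetries

/-! ### Commutators along geodesics -/

section Commutator

variable {E : Type*} [NormedAddCommGroup E] [NormedSpace ℝ E]

theorem covDerivAlong_congr {G : E → E →L[ℝ] E →L[ℝ] ℝ} {c : ℝ → E} {A B : ℝ → E →L[ℝ] E} {t : ℝ}
    (h : A =ᶠ[nhds t] B) : covDerivAlong G c A t = covDerivAlong G c B t := by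
  rw [covDerivAlong, covDerivAlong, h.deriv_eq, h.self_of_nhds]

theorem covDerivAlong_commutator {G : E → E →L[ℝ] E →L[ℝ] ℝ} {c : ℝ → E} {A B : ℝ → E →L[ℝ] E}
    {t : ℝ} (hA : DifferentiableAt ℝ A t) (hB : DifferentiableAt ℝ B t) :
    covDerivAlong G c (fun s => (A s).comp (B s) - (B s).comp (A s)) t =
      (covDerivAlong G c A t).comp (B t) - (B t).comp (covDerivAlong G c A t) +
      ((A t).comp (covDerivAlong G c B t) - (covDerivAlong G c B t).comp (A t)) := by
  have h := (hA.hasDerivAt.clm_comp hB.hasDerivAt).sub (hB.hasDerivAt.clm_comp hA.hasDerivAt)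
  have h' : deriv (fun s => (A s).comp (B s) - (B s).comp (A s)) t = _ := h.deriv
  rw [covDerivAlong, h', covDerivAlong, covDerivAlong]
  ext Y
  simp
  abel

variable [FiniteDimensional ℝ E]

/-- If the Jacobi operator along a geodesic satisfies `∇J/dt = [C, J]` with a parallel `C`, then
`𝓡^{k+1}(c') = [C, 𝓡^k(c')]`. -/
theorem symCurvatureCoord_succ_eq_commutator {G : E → E →L[ℝ] E →L[ℝ] ℝ} {c : ℝ → E}
    {C : ℝ → E →L[ℝ] E} {I : Set ℝ} (hI : IsOpen I)
    (hG : ∀ t ∈ I, ContDiffAt ℝ ∞ G (c t)) (hinv : ∀ t ∈ I, (G (c t)).IsInvertible)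
    (hc : ∀ t ∈ I, DifferentiableAt ℝ c t)
    (hgeo : ∀ t ∈ I, HasDerivAt (deriv c) (-christoffel G (c t) (deriv c t) (deriv c t)) t)
    (hC : ∀ t ∈ I, DifferentiableAt ℝ C t) (hC0 : ∀ t ∈ I, covDerivAlong G c C t = 0)
    (hJ : ∀ t ∈ I, covDerivAlong G c (fun s => jacobiCoord G (c s) (deriv c s)) t =
      (C t).comp (jacobiCoord G (c t) (deriv c t)) - (jacobiCoord G (c t) (deriv c t)).comp (C t))
    (k : ℕ) : ∀ t ∈ I, symCurvatureCoord G (k + 1) (c t) (deriv c t) =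
      (C t).comp (symCurvatureCoord G k (c t) (deriv c t)) -
        (symCurvatureCoord G k (c t) (deriv c t)).comp (C t) := by
  induction k with
  | zero =>
    intro t ht
    rw [← (covDerivAlong_symCurvatureCoord (hG t ht) (hinv t ht) (hc t ht) (hgeo t ht) 0).2]
    simp only [symCurvatureCoord_zero]
    exact hJ t ht
  | succ k ih =>
    intro t ht
    obtain ⟨hd, hk⟩ := covDerivAlong_symCurvatureCoord (hG t ht) (hinv t ht) (hc t ht) (hgeo t ht) k
    -- The identity for `k` holds on a neighbourhood of `t`, so it may be differentiated; the term
    -- with the derivative of `C` drops out.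
    rw [← (covDerivAlong_symCurvatureCoord (hG t ht) (hinv t ht) (hc t ht) (hgeo t ht) (k + 1)).2,
      covDerivAlong_congr (Filter.eventually_of_mem (hI.mem_nhds ht) ih),
      covDerivAlong_commutator (hC t ht) hd, hC0 t ht, hk]
    simp

end Commutator

/-! ### Polynomial dependence of the jet -/

section PolynomialJet

variable {E : Type*} [NormedAddCommGroup E] [NormedSpace ℝ E]

/-- Exactly `k + 2` of the `k + 3` slots hold `X`. -/
theorem symCurvatureCoord_smul (G : E → E →L[ℝ] E →L[ℝ] ℝ) (k : ℕ) (x : E) (t : ℝ) (X : E) :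
    symCurvatureCoord G k x (t • X) = t ^ (k + 2) • symCurvatureCoord G k x X := by
  ext Y
  let κ : Fin (k + 3) := ⟨k, by omega⟩
  have h := (iteratedCovDerivCurvature G k x).map_smul_univ (fun i => if i = κ then 1 else t)
    (Function.update (fun _ => X) κ Y)
  have h1 : (fun i => (if i = κ then (1 : ℝ) else t) • Function.update (fun _ => X) κ Y i) =
      Function.update (fun _ => t • X) κ Y := by
    funext i
    by_cases hi : i = κ
    · subst hi; simp
    · simp [hi]
  have h2 : ∏ i, (if i = κ then (1 : ℝ) else t) = t ^ (k + 2) := by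
    rw [← Finset.mul_prod_erase _ _ (Finset.mem_univ κ), if_pos rfl, one_mul,
      Finset.prod_congr rfl fun i hi => if_neg (Finset.ne_of_mem_erase hi), Finset.prod_const,
      Finset.card_erase_of_mem (Finset.mem_univ κ)]
    simp
  rw [h1, h2] at h
  exact h

variable [FiniteDimensional ℝ E]

theorem symCurvatureCoord_mem_polyFun (G : E → E →L[ℝ] E →L[ℝ] ℝ) (k : ℕ) (x : E)
    (φ : Module.Dual ℝ (E →L[ℝ] E)) :
    (fun X => φ (symCurvatureCoord G k x X)) ∈ PolyFun E := by
  let d := Module.finBasis ℝ E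
  let κ : Fin (k + 3) := ⟨k, by omega⟩
  have hA : ∀ A : E →L[ℝ] E, A = ∑ i, ∑ j, d.coord j (A (d i)) •
      (LinearMap.toContinuousLinearMap (d.coord i)).smulRight (d j) := fun A => by
    ext Y
    conv_lhs => rw [← d.sum_repr Y, map_sum]
    rw [sum_apply]
    refine Finset.sum_congr rfl fun i _ => ?_
    rw [map_smul]
    conv_lhs => rw [← d.sum_repr (A (d i)), Finset.smul_sum]
    rw [sum_apply]
    refine Finset.sum_congr rfl fun j _ => ?_
    simp [smul_smul, mul_comm]
  have : (fun X => φ (symCurvatureCoord G k x X)) = ∑ i, ∑ j,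
      φ ((LinearMap.toContinuousLinearMap (d.coord i)).smulRight (d j)) •
        fun X => d.coord j (symCurvatureCoord G k x X (d i)) := by
    funext X
    conv_lhs => rw [hA (symCurvatureCoord G k x X)]
    simp [mul_comm]
  rw [this]
  refine Subalgebra.sum_mem _ fun i _ => Subalgebra.sum_mem _ fun j _ => Subalgebra.smul_mem _ ?_ _
  refine multilinear_mem_polyFun
    ((d.coord j).compMultilinearMap (iteratedCovDerivCurvature G k x).toMultilinearMap)
    (fun l X => Function.update (fun _ => X) κ (d i) l) fun l ψ => ?_
  by_cases hl : l = κ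
  · subst hl
    simp only [Function.update_self]
    exact Subalgebra.algebraMap_mem _ (ψ (d i))
  · simp only [Function.update_of_ne hl]
    exact dual_mem_polyFun ψ

end PolynomialJet

/-! ### The metric in the preferred chart -/

section ChartMetric

variable {E : Type*} [NormedAddCommGroup E] [NormedSpace ℝ E]
  {M : Type*} [TopologicalSpace M] [ChartedSpace E M] [IsManifold 𝓘(ℝ, E) ∞ M]
  (g : Bundle.ContMDiffRiemannianMetric 𝓘(ℝ, E) ∞ E (fun x : M => TangentSpace 𝓘(ℝ, E) x))

/-- The metric as a function with values in the bilinear forms on the model space. -/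
def modelMetric (q : M) : E →L[ℝ] E →L[ℝ] ℝ := g.inner q

/-- The derivative of the preferred chart at `p`, with values in the endomorphisms of the model
space. -/
def chartDeriv (p q : M) : E →L[ℝ] E := mfderiv 𝓘(ℝ, E) 𝓘(ℝ, E) (chartAt E p) q

/-- The derivative of the inverse of the preferred chart at `p`, with values in the endomorphisms
of the model space. -/
def chartSymmDeriv (p : M) (x : E) : E →L[ℝ] E :=
  mfderiv 𝓘(ℝ, E) 𝓘(ℝ, E) (chartAt E p).symm x

theorem chartMetric_eq (p : M) (x u v : E) :
    chartMetric g (chartAt E p) x u v =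
      modelMetric g ((chartAt E p).symm x) (chartSymmDeriv p x u) (chartSymmDeriv p x v) := rfl

theorem chartDeriv_comp_chartSymmDeriv (p : M) {x : E} (hx : x ∈ (chartAt E p).target) (u : E) :
    chartDeriv p ((chartAt E p).symm x) (chartSymmDeriv p x u) = u := by
  have : IsManifold 𝓘(ℝ, E) 1 M := IsManifold.of_le (n := ∞) (by simp)
  exact DFunLike.congr_fun ((mdifferentiable_chart (I := 𝓘(ℝ, E)) p).comp_symm_deriv hx) u

/-- The tangent space at `p` is the model space, identified through the preferred chart at `p`.
Hence jets and Ricci at `p` agree with their coordinate versions. -/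
theorem chartDeriv_self (p : M) : chartDeriv p p = ContinuousLinearMap.id ℝ E := by
  have : IsManifold 𝓘(ℝ, E) 1 M := IsManifold.of_le (n := ∞) (by simp)
  ext u
  have h := mfderiv_chartAt_eq_tangentCoordChange (I := 𝓘(ℝ, E)) (mem_chart_source E p)
  change (mfderiv 𝓘(ℝ, E) 𝓘(ℝ, E) (chartAt E p) p : E →L[ℝ] E) u = u
  rw [h]
  exact tangentCoordChange_self (I := 𝓘(ℝ, E)) (x := p) (z := p) (v := u) (mem_extChartAt_source p)

theorem chartSymmDeriv_self (p : M) :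
    chartSymmDeriv p (chartAt E p p) = ContinuousLinearMap.id ℝ E := by
  ext u
  have h := chartDeriv_comp_chartSymmDeriv p (mem_chart_target E p) u
  rwa [(chartAt E p).left_inv (mem_chart_source E p), chartDeriv_self] at h

theorem chartMetric_symm (p : M) (x u v : E) :
    chartMetric g (chartAt E p) x u v = chartMetric g (chartAt E p) x v u :=
  g.symm _ _ _

theorem chartMetric_pos (p : M) {x : E} (hx : x ∈ (chartAt E p).target) (v : E) (hv : v ≠ 0) :
    0 < chartMetric g (chartAt E p) x v v := by
  refine g.pos _ _ fun h => hv ?_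
  have h' : chartSymmDeriv p x v = 0 := h
  rw [← chartDeriv_comp_chartSymmDeriv p hx v, h', map_zero]

theorem chartMetric_self (p : M) (u v : E) :
    chartMetric g (chartAt E p) (chartAt E p p) u v = modelMetric g p u v := by
  rw [chartMetric_eq, chartSymmDeriv_self, (chartAt E p).left_inv (mem_chart_source E p)]
  rfl

/-- Coordinate vector fields are smooth: in the trivialization at `p` this one is the constant `u`.
-/
theorem contMDiffAt_chartSymmDeriv (p : M) {x : E} (hx : x ∈ (chartAt E p).target) (u : E) :
    ContMDiffAt 𝓘(ℝ, E) (𝓘(ℝ, E).prod 𝓘(ℝ, E)) ∞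
      (fun y => (⟨(chartAt E p).symm y, chartSymmDeriv p y u⟩ : TangentBundle 𝓘(ℝ, E) M)) x := by
  have : IsManifold 𝓘(ℝ, E) 1 M := IsManifold.of_le (n := ∞) (by simp)
  have hs : ∀ y ∈ (chartAt E p).target, (chartAt E p).symm y ∈ (chartAt E p).source :=
    fun y hy => (chartAt E p).map_target hy
  rw [(trivializationAt E (TangentSpace 𝓘(ℝ, E)) p).contMDiffAt_iff
    (by rw [Bundle.Trivialization.mem_source, TangentBundle.trivializationAt_baseSet]; exact hs x hx)]
  refine ⟨(contMDiffOn_chart_symm x hx).contMDiffAt ((chartAt E p).open_target.mem_nhds hx), ?_⟩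
  refine (contMDiffAt_const (c := u)).congr_of_eventuallyEq ?_
  filter_upwards [(chartAt E p).open_target.mem_nhds hx] with y hy
  have h1 := Bundle.Trivialization.continuousLinearMapAt_apply_of_mem ℝ
    (trivializationAt E (TangentSpace 𝓘(ℝ, E)) p) (b := (chartAt E p).symm y)
    (by rw [TangentBundle.trivializationAt_baseSet]; exact hs y hy)
    (chartSymmDeriv p y u)
  rw [← h1, TangentBundle.continuousLinearMapAt_trivializationAt (hs y hy)]
  exact chartDeriv_comp_chartSymmDeriv p hy u

theorem contDiffAt_chartMetric_apply (p : M) {x : E} (hx : x ∈ (chartAt E p).target) (u v : E) :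
    ContDiffAt ℝ ∞ (fun y => chartMetric g (chartAt E p) y u v) x := by
  have hψ : ContMDiffAt 𝓘(ℝ, E) (𝓘(ℝ, E).prod 𝓘(ℝ, E →L[ℝ] E →L[ℝ] ℝ)) ∞
      (fun y => Bundle.TotalSpace.mk' (E →L[ℝ] E →L[ℝ] ℝ)
        (E := fun q : M => TangentSpace 𝓘(ℝ, E) q →L[ℝ] TangentSpace 𝓘(ℝ, E) q →L[ℝ] ℝ)
        ((chartAt E p).symm y) (g.inner ((chartAt E p).symm y))) x :=
    g.contMDiff.contMDiffAt.comp x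
      ((contMDiffOn_chart_symm x hx).contMDiffAt ((chartAt E p).open_target.mem_nhds hx))
  have : ContMDiffAt 𝓘(ℝ, E) (𝓘(ℝ, E).prod 𝓘(ℝ)) ∞
      (fun y => Bundle.TotalSpace.mk' ℝ (E := Bundle.Trivial M ℝ) ((chartAt E p).symm y)
        (g.inner ((chartAt E p).symm y) (chartSymmDeriv p y u) (chartSymmDeriv p y v))) x := by
    apply ContMDiffAt.clm_bundle_apply₂ (F₁ := E) (F₂ := E)
    · exact hψ
    · exact contMDiffAt_chartSymmDeriv p hx u
    · exact contMDiffAt_chartSymmDeriv p hx v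
  rw [Bundle.contMDiffAt_totalSpace] at this
  exact this.2.contDiffAt

variable [FiniteDimensional ℝ E]

theorem contDiffAt_of_apply {F : Type*} [NormedAddCommGroup F] [NormedSpace ℝ F]
    {A : E → E →L[ℝ] F} {x : E} (h : ∀ Y, ContDiffAt ℝ ∞ (fun s => A s Y) x) :
    ContDiffAt ℝ ∞ A x := by
  let d := Module.finBasis ℝ E
  have hA : A = fun s => ∑ i, ContinuousLinearMap.smulRightL ℝ E F
      (LinearMap.toContinuousLinearMap (d.coord i)) (A s (d i)) := by
    funext s
    ext Y
    conv_lhs => rw [← d.sum_repr Y]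
    simp [-Module.Basis.sum_repr]
  rw [hA]
  exact ContDiffAt.sum fun i _ => (ContinuousLinearMap.contDiff _).contDiffAt.comp x (h (d i))

theorem contDiffAt_chartMetric (p : M) {x : E} (hx : x ∈ (chartAt E p).target) :
    ContDiffAt ℝ ∞ (chartMetric g (chartAt E p)) x :=
  contDiffAt_of_apply fun u => contDiffAt_of_apply fun v => contDiffAt_chartMetric_apply g p hx u v

theorem isInvertible_of_pos {B : E →L[ℝ] E →L[ℝ] ℝ} (hB : ∀ v, v ≠ 0 → 0 < B v v) :
    B.IsInvertible := by
  have hinj : Function.Injective B.toLinearMap := by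
    rw [← LinearMap.ker_eq_bot, LinearMap.ker_eq_bot']
    intro v hv
    by_contra h
    have h1 := hB v h
    have h2 : B v = 0 := hv
    rw [h2] at h1
    simp at h1
  have hdim : Module.finrank ℝ E = Module.finrank ℝ (E →L[ℝ] ℝ) := by
    rw [← (LinearMap.toContinuousLinearMap (𝕜 := ℝ) (E := E) (F' := ℝ)).finrank_eq]
    exact (Subspace.dual_finrank_eq (K := ℝ) (V := E)).symm
  exact ⟨(LinearEquiv.ofInjectiveOfFinrankEq B.toLinearMap hinj hdim).toContinuousLinearEquiv, rfl⟩

theorem isInvertible_chartMetric (p : M) {x : E} (hx : x ∈ (chartAt E p).target) :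
    (chartMetric g (chartAt E p) x).IsInvertible :=
  isInvertible_of_pos (chartMetric_pos g p hx)

omit [FiniteDimensional ℝ E] in
theorem symCurvature_eq (p : M) (k : ℕ) (X : E) :
    (symCurvature g p k X : E →L[ℝ] E) =
      symCurvatureCoord (chartMetric g (chartAt E p)) k (chartAt E p p) X := by
  change (chartDeriv p p).inverse.comp ((symCurvatureCoord (chartMetric g (chartAt E p)) k
    (chartAt E p p) (chartDeriv p p X)).comp (chartDeriv p p)) = _
  rw [chartDeriv_self, ContinuousLinearMap.inverse_id]
  rfl

omit [FiniteDimensional ℝ E] in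
theorem ricci_eq (p : M) (X Y : E) :
    ricci g p X Y = LinearMap.trace ℝ E (((curvature (chartMetric g (chartAt E p))
      (chartAt E p p)).flip X).flip Y : E →L[ℝ] E).toLinearMap := by
  change LinearMap.trace ℝ E (((curvature (chartMetric g (chartAt E p))
      (chartAt E p p)).flip (chartDeriv p p X)).flip (chartDeriv p p Y) : E →L[ℝ] E).toLinearMap = _
  rw [chartDeriv_self]
  rfl

/-- In a `ℭ₀`-space, `𝓡^{k+1}(X)` is the commutator of `𝓡^k(X)` with a skew-symmetric
endomorphism depending on `X` only. -/
theorem exists_skew_commutator (hg : IsC0Space g) (p : M) (X : E) :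
    ∃ S : E →L[ℝ] E,
      (∀ u v, chartMetric g (chartAt E p) (chartAt E p p) (S u) v =
        -chartMetric g (chartAt E p) (chartAt E p p) u (S v)) ∧
      ∀ k, symCurvatureCoord (chartMetric g (chartAt E p)) (k + 1) (chartAt E p p) X =
        S.comp (symCurvatureCoord (chartMetric g (chartAt E p)) k (chartAt E p p) X) -
          (symCurvatureCoord (chartMetric g (chartAt E p)) k (chartAt E p p) X).comp S := by
  set e := chartAt E p with he
  set G := chartMetric g e with hGdef
  have heM : e ∈ IsManifold.maximalAtlas 𝓘(ℝ, E) ∞ M := IsManifold.chart_mem_maximalAtlas p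
  obtain ⟨c, ε, hε, hc0, hc0', hc2, hc⟩ := exists_geodesic_coord e.open_target
    (fun x hx => contDiffAt_chartMetric g p hx) (fun x hx => isInvertible_chartMetric g p hx)
    (mem_chart_target E p) X
  let γ : ℝ → M := fun t => e.symm (c t)
  have hI : IsOpen (Set.Ioo (-ε) ε) := isOpen_Ioo
  -- Outside the interval `c` may leave the target of the chart, so `e ∘ γ` and `c` are only
  -- compared locally.
  have heγ : ∀ t ∈ Set.Ioo (-ε) ε, (e ∘ γ) =ᶠ[nhds t] c := fun t ht => by
    filter_upwards [hI.mem_nhds ht] with s hs using e.right_inv (hc s hs).1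
  have hdγ : ∀ t ∈ Set.Ioo (-ε) ε, deriv (e ∘ γ) t = deriv c t := fun t ht => (heγ t ht).deriv_eq
  have hsrc : ∀ t ∈ Set.Ioo (-ε) ε, γ t ∈ e.source := fun t ht => e.map_target (hc t ht).1
  have hgeo : IsGeodesicOn g γ (Set.Ioo (-ε) ε) := by
    refine ⟨?_, fun t ht => ⟨e, heM, hsrc t ht, ?_⟩⟩
    · exact ((contMDiffOn_chart_symm (n := ∞) (x := p)).of_le (by
        exact WithTop.coe_le_coe.2 (le_top : (2 : ℕ∞) ≤ ⊤))).comp hc2.contMDiffOn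
        fun t ht => (hc t ht).1
    · have h1 : deriv (e ∘ γ) =ᶠ[nhds t] deriv c := by
        filter_upwards [hI.mem_nhds ht] with s hs using hdγ s hs
      have h2 : e (γ t) = c t := (heγ t ht).self_of_nhds
      rw [h1.deriv_eq, hdγ t ht, h2, (hc t ht).2.2.deriv]
      exact neg_add_cancel _
  obtain ⟨C, hCskew, hC⟩ := hg _ γ hI Set.ordConnected_Ioo hgeo
  let Ce : ℝ → E →L[ℝ] E := fun t => endoInChart e (γ t) (C t)
  have h0 : (0 : ℝ) ∈ Set.Ioo (-ε) ε := ⟨by linarith, hε⟩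
  have hγ0 : γ 0 = p := by
    change e.symm (c 0) = p
    rw [hc0, e.left_inv (mem_chart_source E p)]
  have hcov : ∀ A : ℝ → E →L[ℝ] E, ∀ t ∈ Set.Ioo (-ε) ε,
      covDerivAlong G (e ∘ γ) A t = covDerivAlong G c A t := fun A t ht => by
    rw [covDerivAlong, covDerivAlong, hdγ t ht, (heγ t ht).self_of_nhds]
  have hkey := symCurvatureCoord_succ_eq_commutator (G := G) (c := c) (C := Ce) hI
    (fun t ht => contDiffAt_chartMetric g p (hc t ht).1)
    (fun t ht => isInvertible_chartMetric g p (hc t ht).1)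
    (fun t ht => (hc t ht).2.1) (fun t ht => (hc t ht).2.2)
    (fun t ht => (hC e heM t ht (hsrc t ht)).1)
    (fun t ht => (hcov _ t ht).symm.trans (hC e heM t ht (hsrc t ht)).2.1)
    (fun t ht => by
      have h1 := (hC e heM t ht (hsrc t ht)).2.2
      have h2 : (fun s => jacobiCoord G ((e ∘ γ) s) (deriv (e ∘ γ) s)) =ᶠ[nhds t]
          fun s => jacobiCoord G (c s) (deriv c s) := by
        filter_upwards [hI.mem_nhds ht] with s hs
        rw [hdγ s hs, (heγ s hs).self_of_nhds]
      rw [← covDerivAlong_congr h2, ← hcov _ t ht]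
      refine h1.trans ?_
      rw [h2.self_of_nhds])
  refine ⟨Ce 0, fun u v => ?_, fun k => ?_⟩
  · let C₀ : E →L[ℝ] E := C 0
    have hCe : Ce 0 = C₀ := by
      change (chartDeriv p (γ 0)).comp (C₀.comp (chartDeriv p (γ 0)).inverse) = _
      rw [hγ0, chartDeriv_self, ContinuousLinearMap.inverse_id]
      rfl
    have h1 : modelMetric g (γ 0) (C₀ u) v = -modelMetric g (γ 0) u (C₀ v) := hCskew 0 h0 u v
    rw [hGdef, he, chartMetric_self, chartMetric_self, hCe, ← hγ0]
    exact h1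
  · have h1 := hkey k 0 h0
    rwa [hc0, hc0'] at h1

end ChartMetric

/-! ### The trace form -/

section TraceForm

variable {E : Type*} [NormedAddCommGroup E] [NormedSpace ℝ E] [FiniteDimensional ℝ E]

/-- The form `(A, A') ↦ ∑ i, B (A b_i, A' b_i)` on endomorphisms. -/
def traceForm {ι : Type*} [Fintype ι] (B : E →ₗ[ℝ] E →ₗ[ℝ] ℝ) (b : Module.Basis ι ℝ E) :
    (E →L[ℝ] E) →ₗ[ℝ] (E →L[ℝ] E) →ₗ[ℝ] ℝ :=
  LinearMap.mk₂ ℝ (fun A A' => ∑ i, B (A (b i)) (A' (b i)))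
    (fun A₁ A₂ A' => by simp [Finset.sum_add_distrib])
    (fun c A A' => by simp [Finset.mul_sum])
    (fun A A₁ A₂ => by simp [Finset.sum_add_distrib])
    (fun c A A' => by simp [Finset.mul_sum])

omit [FiniteDimensional ℝ E] in
theorem traceForm_apply {ι : Type*} [Fintype ι] (B : E →ₗ[ℝ] E →ₗ[ℝ] ℝ) (b : Module.Basis ι ℝ E)
    (A A' : E →L[ℝ] E) : traceForm B b A A' = ∑ i, B (A (b i)) (A' (b i)) := rfl

omit [FiniteDimensional ℝ E] in
theorem traceForm_symm {ι : Type*} [Fintype ι] {B : E →ₗ[ℝ] E →ₗ[ℝ] ℝ}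
    (hsymm : ∀ x y, B x y = B y x) (b : Module.Basis ι ℝ E) (A A' : E →L[ℝ] E) :
    traceForm B b A A' = traceForm B b A' A :=
  Finset.sum_congr rfl fun i _ => hsymm (A (b i)) (A' (b i))

omit [FiniteDimensional ℝ E] in
theorem traceForm_pos {ι : Type*} [Fintype ι] {B : E →ₗ[ℝ] E →ₗ[ℝ] ℝ}
    (hpos : ∀ x, x ≠ 0 → 0 < B x x) (b : Module.Basis ι ℝ E) (A : E →L[ℝ] E) (hA : A ≠ 0) :
    0 < traceForm B b A A := by
  have hnonneg : ∀ x, 0 ≤ B x x := fun x => by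
    rcases eq_or_ne x 0 with rfl | hx
    · simp
    · exact (hpos x hx).le
  rw [traceForm_apply]
  refine lt_of_le_of_ne (Finset.sum_nonneg fun i _ => hnonneg _) fun h => hA ?_
  have h1 := (Finset.sum_eq_zero_iff_of_nonneg fun i _ => hnonneg (A (b i))).1 h.symm
  have h2 : A.toLinearMap = 0 := b.ext fun i => by
    by_contra hne
    exact (hpos _ hne).ne' (h1 i (Finset.mem_univ i))
  ext x
  exact DFunLike.congr_fun h2 x

/-- The commutator with `S` as a linear map. -/
def commutatorMap (S : E →L[ℝ] E) : (E →L[ℝ] E) →ₗ[ℝ] (E →L[ℝ] E) where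
  toFun A := S.comp A - A.comp S
  map_add' A A' := by
    ext
    simp
    abel
  map_smul' c A := by
    ext
    simp [smul_sub]

omit [FiniteDimensional ℝ E] in
/-- The commutator with a skew-symmetric endomorphism is skew-symmetric for the trace form. -/
theorem traceForm_commutator {ι : Type*} [Fintype ι] [DecidableEq ι] {B : E →ₗ[ℝ] E →ₗ[ℝ] ℝ}
    (hsymm : ∀ x y, B x y = B y x) {b : Module.Basis ι ℝ E}
    (hb : ∀ i j, B (b i) (b j) = if i = j then 1 else 0) {S : E →L[ℝ] E}
    (hS : ∀ u v, B (S u) v = -B u (S v)) (A A' : E →L[ℝ] E) :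
    traceForm B b (commutatorMap S A) A' = -traceForm B b A (commutatorMap S A') := by
  have hexp : ∀ x, x = ∑ j, B x (b j) • b j := fun x => by
    have h1 : ∀ j, B x (b j) = b.repr x j := fun j => by
      conv_lhs => rw [← b.sum_repr x]
      simp [-Module.Basis.sum_repr, hb]
    simp only [h1]
    exact (b.sum_repr x).symm
  have hc : ∀ i j, B (S (b i)) (b j) = -B (S (b j)) (b i) := fun i j => by
    rw [hS, hsymm]
  have hAS : ∀ (A A' : E →L[ℝ] E), ∑ i, B (A (S (b i))) (A' (b i)) =
      ∑ i, ∑ j, B (S (b i)) (b j) * B (A (b j)) (A' (b i)) := fun A A' => by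
    refine Finset.sum_congr rfl fun i _ => ?_
    conv_lhs => rw [hexp (S (b i))]
    simp
  -- Right multiplication by `S` is skew for the trace form, because the matrix of `S` in the
  -- orthonormal basis is antisymmetric.
  have hswap : ∑ i, B (A (S (b i))) (A' (b i)) = -∑ i, B (A (b i)) (A' (S (b i))) := by
    simp only [hsymm (A (b _)) (A' (S (b _)))]
    rw [hAS, hAS, Finset.sum_comm, ← Finset.sum_neg_distrib]
    refine Finset.sum_congr rfl fun i _ => ?_
    rw [← Finset.sum_neg_distrib]
    refine Finset.sum_congr rfl fun j _ => ?_
    rw [hc j i, hsymm (A (b i)), neg_mul]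
  have hl : traceForm B b (commutatorMap S A) A' =
      ∑ i, B (S (A (b i))) (A' (b i)) - ∑ i, B (A (S (b i))) (A' (b i)) := by
    rw [traceForm_apply, ← Finset.sum_sub_distrib]
    exact Finset.sum_congr rfl fun i _ => by simp [commutatorMap]
  have hr : traceForm B b A (commutatorMap S A') =
      ∑ i, B (A (b i)) (S (A' (b i))) - ∑ i, B (A (b i)) (A' (S (b i))) := by
    rw [traceForm_apply, ← Finset.sum_sub_distrib]
    exact Finset.sum_congr rfl fun i _ => by simp [commutatorMap]
  rw [hl, hr, hswap]
  simp only [hS]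
  rw [Finset.sum_neg_distrib]
  ring

omit [FiniteDimensional ℝ E] in
theorem trace_commutatorMap (S A : E →L[ℝ] E) :
    LinearMap.trace ℝ E (commutatorMap S A).toLinearMap = 0 := by
  have : (commutatorMap S A).toLinearMap =
      S.toLinearMap * A.toLinearMap - A.toLinearMap * S.toLinearMap := rfl
  rw [this, map_sub, LinearMap.trace_mul_comm, sub_self]

end TraceForm

end RiemannJet

end

theorem mainTheorem6 {E : Type*} [NormedAddCommGroup E] [NormedSpace ℝ E] [FiniteDimensional ℝ E]
    {M : Type*} [TopologicalSpace M] [ChartedSpace E M] [IsManifold 𝓘(ℝ, E) ∞ M]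
    (g : Bundle.ContMDiffRiemannianMetric 𝓘(ℝ, E) ∞ E (fun x : M => TangentSpace 𝓘(ℝ, E) x))
    (hg : RiemannJet.IsC0Space g) (p : M) :
    ∃ P : Polynomial (RiemannJet.PolyFun (TangentSpace 𝓘(ℝ, E) p)),
      RiemannJet.IsMinimalPolynomial g p P ∧
      (∀ Q, RiemannJet.IsMinimalPolynomial g p Q → Q = P) ∧
      P = ∑ i ∈ Finset.range (P.natDegree / 2 + 1),
        Polynomial.C (RiemannJet.coeffFun P (2 * i)) * Polynomial.X ^ (P.natDegree - 2 * i) ∧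
      (∀ i ≤ P.natDegree / 2, ∀ X : TangentSpace 𝓘(ℝ, E) p,
        0 ≤ (RiemannJet.coeffFun P (2 * i)).1 X) ∧
      (∀ i ≤ P.natDegree / 2, ∀ X ∈ RiemannJet.regularSet g p P.natDegree,
        0 < (RiemannJet.coeffFun P (2 * i)).1 X) ∧
      ((∃ X Y : TangentSpace 𝓘(ℝ, E) p, RiemannJet.ricci g p X Y ≠ 0) → Odd P.natDegree) := by
  open RiemannJet in
  let G := chartMetric g (chartAt E p)
  let x₀ : E := chartAt E p p
  have hsymm : ∀ u v, G x₀ u v = G x₀ v u := chartMetric_symm g p x₀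
  have hpos : ∀ v, v ≠ 0 → 0 < G x₀ v v := chartMetric_pos g p (mem_chart_target E p)
  let B : E →ₗ[ℝ] E →ₗ[ℝ] ℝ := (ContinuousLinearMap.coeLM ℝ).comp (G x₀).toLinearMap
  obtain ⟨b, hb⟩ := exists_orthonormal_basis_of_form B hsymm hpos
  choose S hSskew hS using exists_skew_commutator g hg p
  obtain ⟨P, hPm, hPhom, hPadm, hPreg, hPuniq, hPeven, hPnonneg, hPpos, hPtrace⟩ :=
    exists_minimal_polynomial_of_skew_jet (V := E) (W := E →L[ℝ] E)
      (fun k X => symCurvatureCoord G k x₀ X)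
      (fun k φ => symCurvatureCoord_mem_polyFun G k x₀ φ)
      (fun k t X => symCurvatureCoord_smul G k x₀ t X)
      (traceForm B b) (traceForm_symm hsymm b)
      (traceForm_pos hpos b) (fun X => commutatorMap (S X))
      (fun X A A' => traceForm_commutator hsymm hb (hSskew X) A A')
      (fun k X => hS X k)
  have hadm : ∀ (Q : Polynomial (PolyFun E)) (X : E), (evalJet g p Q X : E →L[ℝ] E) =
      ∑ j ∈ Finset.range (Q.natDegree + 1), (Q.coeff j).1 X • symCurvatureCoord G j x₀ X :=
    fun Q X => Finset.sum_congr rfl fun j _ =>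
      congrArg (fun A : E →L[ℝ] E => (Q.coeff j).1 X • A) (symCurvature_eq g p j X)
  have hregular : ∀ (k : ℕ) (X : E), X ∈ (regularSet g p k : Set E) ↔
      LinearIndependent ℝ fun j : Fin k => symCurvatureCoord G j x₀ X := fun k X => by
    have : (fun j : Fin k => symCurvatureCoord G j x₀ X) =
        fun j : Fin k => (symCurvature g p j X : E →L[ℝ] E) :=
      funext fun j => (symCurvature_eq g p j X).symm
    rw [this]
    exact Iff.rfl
  refine ⟨P, ⟨hPm, hPhom, fun X => (hadm P X).trans (hPadm X), ?_⟩, fun Q hQ => ?_, hPeven,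
    hPnonneg, fun i hi X hX => hPpos i hi X ((hregular _ X).1 hX), ?_⟩
  · obtain ⟨X, hX⟩ := hPreg
    exact ⟨X, (hregular _ X).2 hX⟩
  · obtain ⟨X, hX⟩ := hQ.regular
    exact hPuniq Q hQ.monic (fun X => (hadm Q X).symm.trans (hQ.admissible X))
      ⟨X, (hregular _ X).1 hX⟩
  · rintro ⟨X, Y, hXY⟩
    by_contra hodd
    let τ : Module.Dual ℝ (E →L[ℝ] E) := (LinearMap.trace ℝ E).comp (ContinuousLinearMap.coeLM ℝ)
    let R : E → E → E →L[ℝ] E := fun X Y => ((curvature G x₀).flip X).flip Y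
    -- `R X X` is the Jacobi operator `𝓡^0(X)`, and `τ` vanishes on commutators. This is `Ric(X, X)
    -- = 0`, to be polarized below.
    have hdiag : ∀ X, τ (R X X) = 0 := fun X => by
      have h := hPtrace τ (fun X A => trace_commutatorMap (S X) A) (Nat.not_odd_iff_even.1 hodd) X
      rw [symCurvatureCoord_zero] at h
      exact h
    have hev : ∀ᶠ y in nhds x₀, y ∈ (chartAt E p).target :=
      (chartAt E p).open_target.mem_nhds (mem_chart_target E p)
    have hcomm : ∀ X Y, τ (R X Y) = τ (R Y X) := fun X Y =>
      trace_curvature_comm (contDiffAt_chartMetric g p (mem_chart_target E p))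
        (hev.mono fun y hy => isInvertible_chartMetric g p hy)
        (Filter.Eventually.of_forall fun y => chartMetric_symm g p y) hpos X Y
    have hzero : ∀ X Y, τ (R X Y) = 0 := fun X Y => by
      have hpol : R (X + Y) (X + Y) = R X X + R X Y + (R Y X + R Y Y) := by
        ext Z
        simp [R]
        abel
      have h := hdiag (X + Y)
      rw [hpol, map_add, map_add, map_add, hdiag, hdiag, hcomm Y X] at h
      linarith
    exact hXY ((ricci_eq g p X Y).trans (hzero X Y))
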